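/- Let $k$ be an infinite field of arbitrary characteristic, let $n,d\ge 0$ be integers and let $S=k[x_0,\dots,x_n]$. For a linear subspace $L$ of $\mathbb{P}^n_k$, its ideal $I(L)\subseteq S$ is the ideal of all polynomials that vanish on the affine cone over $L$ (a linear subspace of $k^{n+1}$); it is generated by the linear forms vanishing on $L$. A graded $S$-module $M$ is called $r$-regular (in the sense of Castelnuovo and Mumford), for $r\in\mathbb{Z}$, if in a minimal graded free resolution $$\cdots\longrightarrow\bigoplus_{\alpha}S(-e_{\alpha,1})\longrightarrow\bigoplus_{\alpha}S(-e_{\alpha,0})\longrightarrow M\longrightarrow 0$$ by free modules of finite rank one has $e_{\alpha,i}\le r+i$ for all $\alpha$ and $i$. **Theorem.** Let $X$ be an arrangement of $d$ linear subspaces of $\mathbb{P}^n_k$, with ideals $I_1,\dots,I_d$. Then the ideal $I(X)=I_1\cap\dots\cap I_d$ (which is $S$ if $d=0$) is $d$-regular. The bound is sharp: if $X$ consists of $d$ lines, all different from a fixed auxiliary line $A$, that meet $A$ in $d$ distinct points, then $I(X)$ is not $r$-regular for any $r<d$; and if $n\ge 2$, then such $A$ and $X$ exist in $\mathbb{P}^n_k$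 for every $d$. -/

import Mathlib

open MvPolynomial
open scoped LinearAlgebra.Projectivization

namespace SubspaceArrangement

/-- The graded piece `S_j` of the polynomial ring `S = k[x_s : s ∈ σ]`, for `j : ℤ`: the
polynomials all of whose monomials have degree `j` (so `S_j = 0` for `j < 0`). -/
noncomputable def gradedPiece (k σ : Type*) [Field k] (j : ℤ) :
    Submodule k (MvPolynomial σ k) :=
  restrictSupport k {m : σ →₀ ℕ | (m.degree : ℤ) = j}

/-- The degree `j` piece of the graded free module `⨁_α S(-e_α)`, that is `⨁_α S_{j - e_α}`. -/
noncomputable def freePiece (k σ : Type*) [Field k] {ι : Type*} (e : ι → ℤ) (j : ℤ) :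
    Submodule k (ι → MvPolynomial σ k) :=
  Submodule.pi Set.univ fun α => gradedPiece k σ (j - e α)

/-- The degree `j` piece `I_j = I ∩ S_j` of an ideal `I` of `S`, inside `I`. -/
noncomputable def idealPiece {k σ : Type*} [Field k] (I : Ideal (MvPolynomial σ k)) (j : ℤ) :
    Submodule k I :=
  (gradedPiece k σ j).comap ((Submodule.subtype I).restrictScalars k)

/-- A minimal resolution of a module `M` over `S = k[x_s : s ∈ σ]`, graded by the pieces `ℳ j`,
by graded free modules of finite rank:
`⋯ ⟶ ⨁_α S(-e_{α,1}) ⟶ ⨁_α S(-e_{α,0}) ⟶ M ⟶ 0`.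
The `i`-th free module has rank `rank i` (possibly `0`) and its `α`-th generator has degree
`e_{α,i} = deg i α`. All maps preserve degrees; minimality says that each `∂ i` has image in
`𝔪 F_i`, where `𝔪` is generated by the variables. That only finitely many of the ranks are
nonzero is automatic for finitely many variables (syzygy theorem), and not a separate field. -/
structure MinimalGradedFreeResolution {k σ : Type*} [Field k] {M : Type*} [AddCommGroup M]
    [Module k M] [Module (MvPolynomial σ k) M] (ℳ : ℤ → Submodule k M) where
  rank : ℕ → ℕ
  deg : (i : ℕ) → Fin (rank i) → ℤ
  /-- the differential `F_{i+1} ⟶ F_i` -/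
  diff : (i : ℕ) → (Fin (rank (i + 1)) → MvPolynomial σ k) →ₗ[MvPolynomial σ k]
    (Fin (rank i) → MvPolynomial σ k)
  /-- the augmentation `F_0 ⟶ M` -/
  aug : (Fin (rank 0) → MvPolynomial σ k) →ₗ[MvPolynomial σ k] M
  diff_graded : ∀ (i : ℕ) (j : ℤ), ∀ v ∈ freePiece k σ (deg (i + 1)) j,
    diff i v ∈ freePiece k σ (deg i) j
  aug_graded : ∀ (j : ℤ), ∀ v ∈ freePiece k σ (deg 0) j, aug v ∈ ℳ j
  aug_surjective : Function.Surjective aug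
  exact_zero : Function.Exact (diff 0) aug
  exact_succ : ∀ i : ℕ, Function.Exact (diff (i + 1)) (diff i)
  minimal : ∀ (i : ℕ) (v : Fin (rank (i + 1)) → MvPolynomial σ k) (β : Fin (rank i)),
    diff i v β ∈ Ideal.span (Set.range (X : σ → MvPolynomial σ k))

/-- The graded module `M = ⨁_j ℳ j` is `r`-regular in the sense of Castelnuovo and Mumford: in
its minimal graded free resolution (which is unique up to isomorphism), the generators of the
`i`-th free module have degree at most `r + i`. -/
def IsRegular {k : Type*} (σ : Type*) [Field k] {M : Type*} [AddCommGroup M]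
    [Module k M] [Module (MvPolynomial σ k) M] (ℳ : ℤ → Submodule k M) (r : ℤ) : Prop :=
  ∃ F : MinimalGradedFreeResolution (σ := σ) ℳ,
    ∀ (i : ℕ) (α : Fin (F.rank i)), F.deg i α ≤ r + i

/-- The ideal `I` of `S`, as a graded module, is `r`-regular. -/
def IdealIsRegular {k σ : Type*} [Field k] (I : Ideal (MvPolynomial σ k)) (r : ℤ) : Prop :=
  IsRegular σ (idealPiece I) r

/-- A linear subspace of `ℙⁿ` over `k`. -/
abbrev LinearSubspace (k : Type*) [Field k] (n : ℕ) : Type _ :=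
  Projectivization.Subspace k (Fin (n + 1) → k)

/-- The ideal of a linear subspace `L` of `ℙⁿ`: the polynomials that vanish on the affine cone over
`L`, a linear subspace of `k^{n+1}`. -/
noncomputable def linearSubspaceIdeal {k : Type*} [Field k] {n : ℕ} (L : LinearSubspace k n) :
    Ideal (MvPolynomial (Fin (n + 1)) k) :=
  vanishingIdeal k (Projectivization.Subspace.submodule L : Set (Fin (n + 1) → k))

/-- The ideal `I(X) = I₁ ∩ ⋯ ∩ I_d` of an arrangement of `d` linear subspaces of `ℙⁿ`. -/
noncomputable def arrangementIdeal {k : Type*} [Field k] {n d : ℕ}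
    (L : Fin d → LinearSubspace k n) : Ideal (MvPolynomial (Fin (n + 1)) k) :=
  ⨅ i, linearSubspaceIdeal (L i)

/-- A linear subspace of `ℙⁿ` is a line if its affine cone has dimension two. -/
def IsLine {k : Type*} [Field k] {n : ℕ} (L : LinearSubspace k n) : Prop :=
  Module.finrank k (Projectivization.Subspace.submodule L) = 2

/-- `L₁, …, L_d` are lines, different from the auxiliary line `A`, which they meet in `d` distinct
points. -/
def LinesMeetingLine {k : Type*} [Field k] {n d : ℕ} (A : LinearSubspace k n)
    (L : Fin d → LinearSubspace k n) : Prop :=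
  IsLine A ∧ (∀ i, IsLine (L i) ∧ L i ≠ A) ∧
    ∃ p : Fin d → ℙ k (Fin (n + 1) → k), Function.Injective p ∧ ∀ i, p i ∈ L i ∧ p i ∈ A

end SubspaceArrangement

open SubspaceArrangement

/-! Over an infinite field the ideal of a subspace is generated by its space `W i` of linear forms;
write `I_T` for the intersection of the ideals `(W i)` over `i ∈ T`. The bound is proved by
induction on `T` and on the sum of the dimensions of the subspaces. A generic linear form `h` is a
nonzerodivisor modulo `I_T` when no `W i` is everything, so `I_T` is `|T|`-regular as soon as `I_T +
(h)` is. The hyperplane section, with ideals `(W i + h)`, has smaller dimension, so its ideal is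
`|T|`-regular by induction. It contains `I_T + (h)`, and two such ideals that agree in degrees at
least `|T|` share `|T|`-regularity.

The core is therefore that forms of degree at least `|T|` lift from the section (`liftingProperty`).
If the `W i` do not span all linear forms, a projection that kills `h` and fixes every `W i` does
it. If they span, lifts for the sets `T \ i` have to be patched together, which is a gluing problem
in degree at least `|T| - 1` (`gluingProperty_of_liftingProperty`). Gluing is solved by passing to
hyperplane sections; the error is a multiple of `h`, and it can be corrected because `h` is a sum of
elements of the `W i`.

The homological part avoids Tor: it works with partial free resolutions with bounded generator
degrees, moved along short exact sequences by the horseshoe lemma and a pullback. A minimal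
resolution is assembled at the end from covers of minimal rank.

For sharpness, a form of degree less than `d` in the ideal has `d` zeros on the line `A`, hence
vanishes on `A`, whereas a product of `d` linear forms in the ideal does not. -/

namespace SubspaceArrangement

universe u

/-! ### Homogeneous components and graded ideals -/

section Grading

variable {k σ : Type*} [Field k]

theorem mem_gradedPiece_iff {j : ℤ} {f : MvPolynomial σ k} :
    f ∈ gradedPiece k σ j ↔ ∀ m : σ →₀ ℕ, coeff m f ≠ 0 → (m.degree : ℤ) = j := by
  rw [gradedPiece, mem_restrictSupport_iff]
  simp [Set.subset_def]

theorem mem_gradedPiece_natCast {n : ℕ} {f : MvPolynomial σ k} :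
    f ∈ gradedPiece k σ (n : ℤ) ↔ f.IsHomogeneous n := by
  have h : ∀ m : σ →₀ ℕ, Finsupp.weight 1 m = m.degree := fun m => by
    rw [Finsupp.degree_eq_weight_one]; rfl
  rw [mem_gradedPiece_iff, IsHomogeneous, IsWeightedHomogeneous]
  simp only [h, Nat.cast_inj]

theorem eq_zero_of_mem_gradedPiece_neg {j : ℤ} (hj : j < 0) {f : MvPolynomial σ k}
    (hf : f ∈ gradedPiece k σ j) : f = 0 := by
  rw [mem_gradedPiece_iff] at hf
  ext m
  by_contra h
  have := hf m h
  omega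

theorem mul_mem_gradedPiece {a b : ℤ} {f g : MvPolynomial σ k} (hf : f ∈ gradedPiece k σ a)
    (hg : g ∈ gradedPiece k σ b) : f * g ∈ gradedPiece k σ (a + b) := by
  classical
  rw [mem_gradedPiece_iff] at *
  intro m hm
  rw [coeff_mul] at hm
  obtain ⟨x, hx, hne⟩ := Finset.exists_ne_zero_of_sum_ne_zero hm
  rw [Finset.HasAntidiagonal.mem_antidiagonal] at hx
  rw [← hf x.1 (left_ne_zero_of_mul hne), ← hg x.2 (right_ne_zero_of_mul hne), ← hx]
  simp

theorem one_mem_gradedPiece : (1 : MvPolynomial σ k) ∈ gradedPiece k σ 0 :=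
  mem_gradedPiece_natCast.2 (isHomogeneous_one σ k)

theorem C_mem_gradedPiece (c : k) : (C c : MvPolynomial σ k) ∈ gradedPiece k σ 0 :=
  mem_gradedPiece_natCast.2 (isHomogeneous_C σ c)

theorem X_mem_gradedPiece (i : σ) : (X i : MvPolynomial σ k) ∈ gradedPiece k σ 1 :=
  mem_gradedPiece_natCast.2 (isHomogeneous_X k i)

theorem monomial_mem_gradedPiece (m : σ →₀ ℕ) (c : k) :
    monomial m c ∈ gradedPiece k σ (m.degree : ℤ) :=
  mem_gradedPiece_natCast.2 (isHomogeneous_monomial c rfl)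

theorem eq_C_of_mem_gradedPiece_zero {f : MvPolynomial σ k} (hf : f ∈ gradedPiece k σ 0) :
    f = C (coeff 0 f) := by
  classical
  rw [mem_gradedPiece_iff] at hf
  ext m
  rw [coeff_C]
  split_ifs with h
  · rw [h]
  · by_contra hne
    have := hf m hne
    apply h
    have h0 : m.degree = 0 := by exact_mod_cast this
    exact ((Finsupp.degree_eq_zero_iff m).1 h0).symm

variable (k σ) in
/-- The projection of `S` onto `S_j`. -/
noncomputable def gradedComponent (j : ℤ) : MvPolynomial σ k →ₗ[k] MvPolynomial σ k :=
  if 0 ≤ j then homogeneousComponent j.toNat else 0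

theorem coeff_gradedComponent (j : ℤ) (m : σ →₀ ℕ) (f : MvPolynomial σ k) :
    coeff m (gradedComponent k σ j f) = if (m.degree : ℤ) = j then coeff m f else 0 := by
  rw [gradedComponent]
  split_ifs with h h1 h1
  · rw [coeff_homogeneousComponent, if_pos (by omega)]
  · rw [coeff_homogeneousComponent, if_neg (by omega)]
  · omega
  · simp

theorem gradedComponent_mem (j : ℤ) (f : MvPolynomial σ k) :
    gradedComponent k σ j f ∈ gradedPiece k σ j := by
  rw [mem_gradedPiece_iff]
  intro m hm
  rw [coeff_gradedComponent] at hm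
  by_contra h
  simp [h] at hm

theorem gradedComponent_of_mem {j : ℤ} {f : MvPolynomial σ k} (hf : f ∈ gradedPiece k σ j) :
    gradedComponent k σ j f = f := by
  rw [mem_gradedPiece_iff] at hf
  ext m
  rw [coeff_gradedComponent]
  split_ifs with h
  · rfl
  · by_contra hne
    exact h (hf m (Ne.symm hne))

theorem gradedComponent_of_mem_of_ne {i j : ℤ} (hij : i ≠ j) {f : MvPolynomial σ k}
    (hf : f ∈ gradedPiece k σ i) : gradedComponent k σ j f = 0 := by
  rw [mem_gradedPiece_iff] at hf
  ext m
  rw [coeff_gradedComponent]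
  split_ifs with h
  · by_contra hne
    exact hij ((hf m hne).symm.trans h)
  · simp

theorem gradedComponent_mul {a : ℤ} {f : MvPolynomial σ k} (hf : f ∈ gradedPiece k σ a)
    (g : MvPolynomial σ k) (j : ℤ) :
    gradedComponent k σ (a + j) (f * g) = f * gradedComponent k σ j g := by
  induction g using MvPolynomial.induction_on' with
  | add p q hp hq => rw [mul_add, map_add, hp, hq, map_add, mul_add]
  | monomial m c =>
    have h1 := monomial_mem_gradedPiece (k := k) m c
    have h2 := mul_mem_gradedPiece hf h1
    by_cases h : (m.degree : ℤ) = j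
    · subst h
      rw [gradedComponent_of_mem h1, gradedComponent_of_mem h2]
    · rw [gradedComponent_of_mem_of_ne h h1, gradedComponent_of_mem_of_ne (by omega) h2, mul_zero]

theorem gradedComponent_mul' {a : ℤ} {f : MvPolynomial σ k} (hf : f ∈ gradedPiece k σ a)
    (g : MvPolynomial σ k) (j : ℤ) :
    gradedComponent k σ j (f * g) = f * gradedComponent k σ (j - a) g := by
  rw [← gradedComponent_mul hf, add_sub_cancel]

theorem exists_sum_gradedComponent (f : MvPolynomial σ k) :
    ∃ N : ℕ, ∀ N' ≥ N, f = ∑ i ∈ Finset.range N', gradedComponent k σ (i : ℤ) f := by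
  refine ⟨f.totalDegree + 1, fun N' hN => ?_⟩
  ext m
  rw [coeff_sum]
  simp only [coeff_gradedComponent, Nat.cast_inj, Finset.sum_ite_eq, Finset.mem_range]
  split_ifs with h
  · rfl
  · by_contra hne
    have := le_totalDegree (mem_support_iff.2 hne)
    change m.degree ≤ _ at this
    omega

theorem mem_of_mul_mem_gradedPiece {a j : ℤ} {f g : MvPolynomial σ k}
    (hf : f ∈ gradedPiece k σ a) (hf0 : f ≠ 0) (h : f * g ∈ gradedPiece k σ (a + j)) :
    g ∈ gradedPiece k σ j := by
  have := gradedComponent_mul hf g j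
  rw [gradedComponent_of_mem h] at this
  rw [mul_left_cancel₀ hf0 this]
  exact gradedComponent_mem j g

/-- An ideal is graded if it contains the homogeneous components of its elements. -/
def IsGradedIdeal (I : Ideal (MvPolynomial σ k)) : Prop :=
  ∀ f ∈ I, ∀ j : ℤ, gradedComponent k σ j f ∈ I

theorem IsGradedIdeal.sup {I J : Ideal (MvPolynomial σ k)} (hI : IsGradedIdeal I)
    (hJ : IsGradedIdeal J) : IsGradedIdeal (I ⊔ J) := by
  intro f hf j
  obtain ⟨a, ha, b, hb, rfl⟩ := Submodule.mem_sup.1 hf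
  rw [map_add]
  exact Submodule.add_mem_sup (hI a ha j) (hJ b hb j)

theorem IsGradedIdeal.iInf {ι : Sort*} {I : ι → Ideal (MvPolynomial σ k)}
    (hI : ∀ i, IsGradedIdeal (I i)) : IsGradedIdeal (⨅ i, I i) := by
  intro f hf j
  rw [Submodule.mem_iInf] at *
  exact fun i => hI i f (hf i) j

theorem IsGradedIdeal.span {s : Set (MvPolynomial σ k)}
    (hs : ∀ f ∈ s, ∃ j, f ∈ gradedPiece k σ j) : IsGradedIdeal (Ideal.span s) := by
  intro f hf j
  induction hf using Submodule.span_induction generalizing j with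
  | mem x hx =>
    obtain ⟨a, ha⟩ := hs x hx
    by_cases h : a = j
    · subst h
      rw [gradedComponent_of_mem ha]
      exact Ideal.subset_span hx
    · rw [gradedComponent_of_mem_of_ne h ha]
      exact zero_mem _
  | zero => simp
  | add x y _ _ hx hy => rw [map_add]; exact add_mem (hx j) (hy j)
  | smul a x _ hx =>
    rw [smul_eq_mul]
    induction a using MvPolynomial.induction_on' with
    | add p q hp hq => rw [add_mul, map_add]; exact add_mem hp hq
    | monomial m c =>
      rw [gradedComponent_mul' (monomial_mem_gradedPiece m c)]
      exact Ideal.mul_mem_left _ _ (hx _)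

theorem IsGradedIdeal.sup_span {I : Ideal (MvPolynomial σ k)} (hI : IsGradedIdeal I)
    {h : MvPolynomial σ k} {a : ℤ} (hh : h ∈ gradedPiece k σ a) :
    IsGradedIdeal (I ⊔ Ideal.span {h}) :=
  hI.sup (IsGradedIdeal.span (by simpa using ⟨a, hh⟩))

theorem exists_of_mem_sup_span {I : Ideal (MvPolynomial σ k)} (hI : IsGradedIdeal I)
    {h : MvPolynomial σ k} {a : ℤ} (hh : h ∈ gradedPiece k σ a) {j : ℤ} {f : MvPolynomial σ k}
    (hf : f ∈ gradedPiece k σ j) (hfI : f ∈ I ⊔ Ideal.span {h}) :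
    ∃ u ∈ I, u ∈ gradedPiece k σ j ∧ ∃ b ∈ gradedPiece k σ (j - a), f = u + h * b := by
  obtain ⟨u, hu, v, hv, rfl⟩ := Submodule.mem_sup.1 hfI
  obtain ⟨b, rfl⟩ := Ideal.mem_span_singleton'.1 hv
  refine ⟨gradedComponent k σ j u, hI u hu j, gradedComponent_mem _ _,
    gradedComponent k σ (j - a) b, gradedComponent_mem _ _, ?_⟩
  rw [← gradedComponent_mul' hh, ← map_add, mul_comm h b, gradedComponent_of_mem hf]

end Grading

/-! ### Ideals generated by linear forms -/

section LinearForms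

variable {k σ : Type*} [Field k] [Fintype σ]

variable (k σ) in
/-- The linear form with given coefficients. -/
noncomputable def linearForm : (σ → k) →ₗ[k] MvPolynomial σ k :=
  Fintype.linearCombination k (X : σ → MvPolynomial σ k)

theorem linearForm_apply (c : σ → k) : linearForm k σ c = ∑ i, c i • X i :=
  Fintype.linearCombination_apply k X c

theorem linearForm_single [DecidableEq σ] (i : σ) : linearForm k σ (Pi.single i 1) = X i := by
  rw [linearForm, Fintype.linearCombination_apply_single, one_smul]

theorem linearForm_mem (c : σ → k) : linearForm k σ c ∈ gradedPiece k σ 1 := by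
  rw [linearForm_apply]
  exact Submodule.sum_mem _ fun i _ => Submodule.smul_mem _ _ (X_mem_gradedPiece i)

theorem aeval_linearForm (p c : σ → k) : aeval p (linearForm k σ c) = ∑ i, c i * p i := by
  simp [linearForm_apply]

theorem linearForm_injective : Function.Injective (linearForm k σ) := by
  classical
  rw [injective_iff_map_eq_zero]
  intro c hc
  ext i
  have := congrArg (aeval (Pi.single i 1 : σ → k)) hc
  simpa [aeval_linearForm, Pi.single_apply] using this

/-- The ideal generated by a space of linear forms. -/
noncomputable def linearFormIdeal (W : Submodule k (σ → k)) : Ideal (MvPolynomial σ k) :=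
  Ideal.span (linearForm k σ '' W)

theorem linearForm_mem_linearFormIdeal {W : Submodule k (σ → k)} {c : σ → k} (hc : c ∈ W) :
    linearForm k σ c ∈ linearFormIdeal W :=
  Ideal.subset_span ⟨c, hc, rfl⟩

theorem linearFormIdeal_mono {W W' : Submodule k (σ → k)} (h : W ≤ W') :
    linearFormIdeal W ≤ linearFormIdeal W' :=
  Ideal.span_mono (Set.image_mono h)

theorem isGradedIdeal_linearFormIdeal (W : Submodule k (σ → k)) :
    IsGradedIdeal (linearFormIdeal W) := by
  apply IsGradedIdeal.span
  rintro _ ⟨c, -, rfl⟩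
  exact ⟨1, linearForm_mem c⟩

theorem linearFormIdeal_sup_span (W : Submodule k (σ → k)) (h : σ → k) :
    linearFormIdeal (W ⊔ Submodule.span k {h}) =
      linearFormIdeal W ⊔ Ideal.span {linearForm k σ h} := by
  apply le_antisymm
  · refine Ideal.span_le.2 ?_
    rintro _ ⟨c, hc, rfl⟩
    obtain ⟨w, hw, v, hv, rfl⟩ := Submodule.mem_sup.1 hc
    obtain ⟨a, rfl⟩ := Submodule.mem_span_singleton.1 hv
    rw [map_add, map_smul, smul_eq_C_mul]
    exact Submodule.add_mem_sup (linearForm_mem_linearFormIdeal hw)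
      (Ideal.mul_mem_left _ _ (Ideal.mem_span_singleton_self _))
  · refine sup_le (linearFormIdeal_mono le_sup_left) ?_
    rw [Ideal.span_singleton_le_iff_mem]
    exact linearForm_mem_linearFormIdeal
      (Submodule.mem_sup_right (Submodule.mem_span_singleton_self h))

/-- The substitution of linear forms given by a linear endomorphism of `S_1`. -/
noncomputable def linearSubst (π : (σ → k) →ₗ[k] (σ → k)) :
    MvPolynomial σ k →ₐ[k] MvPolynomial σ k :=
  by classical exact aeval fun i => linearForm k σ (π (Pi.single i 1))

theorem linearSubst_linearForm (π : (σ → k) →ₗ[k] (σ → k)) (c : σ → k) :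
    linearSubst π (linearForm k σ c) = linearForm k σ (π c) := by
  classical
  have : (linearSubst π).toLinearMap ∘ₗ linearForm k σ = linearForm k σ ∘ₗ π := by
    refine LinearMap.pi_ext' fun i => LinearMap.ext_ring ?_
    simp only [LinearMap.comp_apply, LinearMap.single_apply]
    rw [linearForm_single, linearSubst]
    simp
  exact LinearMap.congr_fun this c

theorem sub_linearSubst_mem (π : (σ → k) →ₗ[k] (σ → k)) {W : Submodule k (σ → k)}
    (h : ∀ c, c - π c ∈ W) (f : MvPolynomial σ k) : f - linearSubst π f ∈ linearFormIdeal W := by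
  classical
  rw [← Ideal.Quotient.eq]
  have : (Ideal.Quotient.mkₐ k (linearFormIdeal W)) =
      (Ideal.Quotient.mkₐ k (linearFormIdeal W)).comp (linearSubst π) := by
    refine MvPolynomial.algHom_ext fun i => ?_
    rw [AlgHom.comp_apply, ← linearForm_single, linearSubst_linearForm]
    change Ideal.Quotient.mk _ _ = Ideal.Quotient.mk _ _
    rw [Ideal.Quotient.eq, ← map_sub]
    exact linearForm_mem_linearFormIdeal (h _)
  exact DFunLike.congr_fun this f

theorem linearSubst_eq_zero (π : (σ → k) →ₗ[k] (σ → k)) {W : Submodule k (σ → k)}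
    (h : ∀ c ∈ W, π c = 0) {f : MvPolynomial σ k} (hf : f ∈ linearFormIdeal W) :
    linearSubst π f = 0 := by
  have : linearFormIdeal W ≤ RingHom.ker (linearSubst π) := by
    refine Ideal.span_le.2 ?_
    rintro _ ⟨c, hc, rfl⟩
    simp [RingHom.mem_ker, linearSubst_linearForm, h c hc]
  exact this hf

theorem linearSubst_mem_linearFormIdeal (π : (σ → k) →ₗ[k] (σ → k)) {W : Submodule k (σ → k)}
    (h : ∀ c ∈ W, π c = c) {f : MvPolynomial σ k} (hf : f ∈ linearFormIdeal W) :
    linearSubst π f ∈ linearFormIdeal W := by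
  have : linearFormIdeal W ≤ (linearFormIdeal W).comap (linearSubst π) := by
    refine Ideal.span_le.2 ?_
    rintro _ ⟨c, hc, rfl⟩
    simpa [linearSubst_linearForm, h c hc] using linearForm_mem_linearFormIdeal hc
  exact this hf

/-- Choosing a complement of `W` embeds `S/(W)` into `S` as a polynomial subring. Substituting along
`π` then tests membership in `(W)`, and primality of `(W)` follows from `S` being a domain. -/
theorem exists_retraction (W : Submodule k (σ → k)) :
    ∃ π : (σ → k) →ₗ[k] (σ → k), (∀ c ∈ W, π c = 0) ∧ ∀ c, c - π c ∈ W := by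
  obtain ⟨g, hg⟩ := W.mkQ.exists_rightInverse_of_surjective (by simp)
  refine ⟨g ∘ₗ W.mkQ, fun c hc => ?_, fun c => ?_⟩
  · rw [LinearMap.comp_apply, W.mkQ_apply, (Submodule.Quotient.mk_eq_zero W).2 hc, map_zero]
  · rw [← Submodule.Quotient.mk_eq_zero, ← W.mkQ_apply, map_sub, LinearMap.comp_apply]
    have := LinearMap.congr_fun hg (W.mkQ c)
    simp only [LinearMap.comp_apply, LinearMap.id_apply] at this
    rw [this, sub_self]

theorem mem_linearFormIdeal_iff (π : (σ → k) →ₗ[k] (σ → k)) {W : Submodule k (σ → k)}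
    (h : ∀ c ∈ W, π c = 0) (h' : ∀ c, c - π c ∈ W) {f : MvPolynomial σ k} :
    f ∈ linearFormIdeal W ↔ linearSubst π f = 0 := by
  refine ⟨linearSubst_eq_zero π h, fun hf => ?_⟩
  simpa [hf] using sub_linearSubst_mem π h' f

theorem linearFormIdeal_mem_or_mem {W : Submodule k (σ → k)} {f g : MvPolynomial σ k}
    (hfg : f * g ∈ linearFormIdeal W) : f ∈ linearFormIdeal W ∨ g ∈ linearFormIdeal W := by
  obtain ⟨π, h, h'⟩ := exists_retraction W
  rw [mem_linearFormIdeal_iff π h h', map_mul, mul_eq_zero] at hfg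
  simpa only [mem_linearFormIdeal_iff π h h'] using hfg

theorem linearForm_mem_linearFormIdeal_iff {W : Submodule k (σ → k)} {c : σ → k} :
    linearForm k σ c ∈ linearFormIdeal W ↔ c ∈ W := by
  refine ⟨fun hc => ?_, linearForm_mem_linearFormIdeal⟩
  obtain ⟨π, h, h'⟩ := exists_retraction W
  rw [mem_linearFormIdeal_iff π h h', linearSubst_linearForm] at hc
  have := h' c
  rwa [(map_eq_zero_iff _ linearForm_injective).1 hc, sub_zero] at this

theorem mem_linearFormIdeal_of_mul_mem {W : Submodule k (σ → k)} {c : σ → k} (hc : c ∉ W)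
    {f : MvPolynomial σ k} (hf : linearForm k σ c * f ∈ linearFormIdeal W) :
    f ∈ linearFormIdeal W :=
  (linearFormIdeal_mem_or_mem hf).resolve_left (mt linearForm_mem_linearFormIdeal_iff.1 hc)

theorem mem_linearFormIdeal_top {j : ℤ} (hj : 0 < j) {f : MvPolynomial σ k}
    (hf : f ∈ gradedPiece k σ j) : f ∈ linearFormIdeal (⊤ : Submodule k (σ → k)) := by
  rw [mem_linearFormIdeal_iff 0 (by simp) (by simp), linearSubst]
  simp only [LinearMap.zero_apply, map_zero]
  rw [← Pi.zero_def, MvPolynomial.aeval_zero]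
  have : constantCoeff f = 0 := by
    by_contra h
    have := mem_gradedPiece_iff.1 hf 0 h
    simp at this
    omega
  rw [this, map_zero]

theorem linearFormIdeal_le_span_X (W : Submodule k (σ → k)) :
    linearFormIdeal W ≤ Ideal.span (Set.range (X : σ → MvPolynomial σ k)) := by
  refine Ideal.span_le.2 ?_
  rintro _ ⟨c, -, rfl⟩
  rw [linearForm_apply, SetLike.mem_coe]
  refine sum_mem fun i _ => ?_
  rw [smul_eq_C_mul]
  exact Ideal.mul_mem_left _ _ (Ideal.subset_span ⟨i, rfl⟩)

theorem mem_span_X_of_mem_gradedPiece {j : ℤ} (hj : 0 < j) {f : MvPolynomial σ k}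
    (hf : f ∈ gradedPiece k σ j) : f ∈ Ideal.span (Set.range (X : σ → MvPolynomial σ k)) :=
  linearFormIdeal_le_span_X _ (mem_linearFormIdeal_top hj hf)

/-- The linear forms that vanish on a subspace of `k^σ`. -/
def vanishingForms (L : Submodule k (σ → k)) : Submodule k (σ → k) where
  carrier := {c | ∀ p ∈ L, ∑ i, c i * p i = 0}
  zero_mem' := by simp
  add_mem' := by
    intro a b ha hb p hp
    simp [add_mul, Finset.sum_add_distrib, ha p hp, hb p hp]
  smul_mem' := by
    intro r a ha p hp
    simp [mul_assoc, ← Finset.mul_sum, ha p hp]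

theorem exists_mem_vanishingForms {L : Submodule k (σ → k)} {q : σ → k} (hq : q ∉ L) :
    ∃ c ∈ vanishingForms L, ∑ i, c i * q i ≠ 0 := by
  classical
  obtain ⟨φ, hφ, hL⟩ := Submodule.exists_le_ker_of_notMem hq
  have key : ∀ p : σ → k, ∑ i, φ (Pi.single i 1) * p i = φ p := by
    intro p
    conv_rhs => rw [pi_eq_sum_univ p, map_sum]
    refine Finset.sum_congr rfl fun i _ => ?_
    rw [map_smul, smul_eq_mul, mul_comm]
    congr 2
    ext j
    simp [Pi.single_apply, eq_comm]
  refine ⟨fun i => φ (Pi.single i 1), fun p hp => ?_, ?_⟩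
  · rw [key]
    exact hL hp
  · rwa [key]

theorem vanishingIdeal_eq_linearFormIdeal [Infinite k] (L : Submodule k (σ → k)) :
    vanishingIdeal k (L : Set (σ → k)) = linearFormIdeal (vanishingForms L) := by
  classical
  apply le_antisymm
  · intro f hf
    obtain ⟨π, h, h'⟩ := exists_retraction (vanishingForms L)
    rw [mem_linearFormIdeal_iff π h h']
    refine MvPolynomial.funext fun p => ?_
    rw [map_zero]
    -- Evaluating the substituted polynomial at `p` amounts to evaluating `f` at the transpose of
    -- `π` applied to `p`. That point is killed by all forms vanishing on `L`, so it lies in `L`. As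
    -- `k` is infinite, vanishing at all `p` makes the substituted polynomial zero.
    have hmem : (fun i => ∑ l, π (Pi.single i 1) l * p l) ∈ L := by
      by_contra hq
      obtain ⟨c, hc, hne⟩ := exists_mem_vanishingForms hq
      apply hne
      have h1 : aeval p (linearForm k σ (π c)) = 0 := by rw [h c hc, map_zero, map_zero]
      rw [← linearSubst_linearForm, linearForm_apply, linearSubst] at h1
      simpa [aeval_linearForm] using h1
    have := hf _ hmem
    simp only [← aeval_linearForm] at this
    rw [linearSubst, ← coe_aeval_eq_eval, AlgHom.coe_toRingHom, ← AlgHom.comp_apply, comp_aeval]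
    exact this
  · refine Ideal.span_le.2 ?_
    rintro _ ⟨c, hc, rfl⟩ p hp
    rw [aeval_linearForm]
    exact hc p hp

end LinearForms

/-! ### Lifting forms from a generic hyperplane section -/

section Lifting

variable {k σ ι : Type*} [Field k]

/-- The linear form `h` avoids all the proper sums of the spaces `W i`. -/
def IsGenericForm (W : ι → Submodule k (σ → k)) (T : Finset ι) (h : σ → k) : Prop :=
  ∀ U ⊆ T, ⨆ i ∈ U, W i ≠ ⊤ → h ∉ ⨆ i ∈ U, W i

theorem IsGenericForm.mono {W : ι → Submodule k (σ → k)} {T U : Finset ι} {h : σ → k}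
    (hh : IsGenericForm W T h) (hU : U ⊆ T) : IsGenericForm W U h :=
  fun U' hU' => hh U' (hU'.trans hU)

theorem IsGenericForm.notMem {W : ι → Submodule k (σ → k)} {T : Finset ι} {h : σ → k}
    (hh : IsGenericForm W T h) {i : ι} (hi : i ∈ T) (hW : W i ≠ ⊤) : h ∉ W i := by
  have := hh {i} (by simpa using hi)
  simp only [Finset.mem_singleton, iSup_iSup_eq_left] at this
  exact this hW

/-- A vector space over an infinite field is not a finite union of proper subspaces. -/
theorem exists_isGenericForm [Infinite k] (W : ι → Submodule k (σ → k)) (T : Finset ι) :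
    ∃ h, IsGenericForm W T h := by
  classical
  let s : Finset (Submodule k (σ → k)) := (T.powerset.image fun U => ⨆ i ∈ U, W i).erase ⊤
  have hs : ⊤ ∉ s := Finset.notMem_erase _ _
  have := Subspace.biUnion_ne_univ_of_top_notMem hs
  obtain ⟨h, hh⟩ := (Set.ne_univ_iff_exists_notMem _).1 this
  refine ⟨h, fun U hU hne hmem => hh ?_⟩
  simp only [Set.mem_iUnion]
  refine ⟨⨆ i ∈ U, W i, ?_, hmem⟩
  exact Finset.mem_erase.2 ⟨hne, Finset.mem_image.2 ⟨U, Finset.mem_powerset.2 hU, rfl⟩⟩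

variable [Fintype σ]

/-- The intersection of the linear ideals indexed by a finite set. -/
noncomputable def linearIdealInf (W : ι → Submodule k (σ → k)) (T : Finset ι) :
    Ideal (MvPolynomial σ k) :=
  ⨅ i ∈ T, linearFormIdeal (W i)

theorem mem_linearIdealInf {W : ι → Submodule k (σ → k)} {T : Finset ι} {f : MvPolynomial σ k} :
    f ∈ linearIdealInf W T ↔ ∀ i ∈ T, f ∈ linearFormIdeal (W i) := by
  simp [linearIdealInf, Submodule.mem_iInf]

theorem isGradedIdeal_linearIdealInf (W : ι → Submodule k (σ → k)) (T : Finset ι) :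
    IsGradedIdeal (linearIdealInf W T) :=
  .iInf fun _ => .iInf fun _ => isGradedIdeal_linearFormIdeal _

theorem linearIdealInf_anti (W : ι → Submodule k (σ → k)) {T U : Finset ι} (h : U ⊆ T) :
    linearIdealInf W T ≤ linearIdealInf W U := fun _ hf =>
  mem_linearIdealInf.2 fun i hi => mem_linearIdealInf.1 hf i (h hi)

theorem linearIdealInf_mono {W W' : ι → Submodule k (σ → k)} (h : ∀ i, W i ≤ W' i)
    (T : Finset ι) : linearIdealInf W T ≤ linearIdealInf W' T := fun _ hf =>
  mem_linearIdealInf.2 fun i hi => linearFormIdeal_mono (h i) (mem_linearIdealInf.1 hf i hi)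

theorem mem_linearIdealInf_of_mul_mem {W : ι → Submodule k (σ → k)} {T : Finset ι} {h : σ → k}
    (hh : ∀ i ∈ T, h ∉ W i) {f : MvPolynomial σ k}
    (hf : linearForm k σ h * f ∈ linearIdealInf W T) : f ∈ linearIdealInf W T :=
  mem_linearIdealInf.2 fun i hi =>
    mem_linearFormIdeal_of_mul_mem (hh i hi) (mem_linearIdealInf.1 hf i hi)

/-- If the subspaces have a common point off the hyperplane `h = 0`, then all polynomials that
vanish on the hyperplane section of the arrangement lift. -/
theorem mem_sup_span_of_notMem_iSup {W : ι → Submodule k (σ → k)} {T : Finset ι} {h : σ → k}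
    (hh : h ∉ ⨆ i ∈ T, W i) {f : MvPolynomial σ k}
    (hf : f ∈ linearIdealInf (fun i => W i ⊔ Submodule.span k {h}) T) :
    f ∈ linearIdealInf W T ⊔ Ideal.span {linearForm k σ h} := by
  obtain ⟨φ, hφ, hV⟩ := Submodule.exists_le_ker_of_notMem hh
  -- This is the projection onto `ker φ` along `h`. It kills `h`, and it fixes every `W i` because
  -- `φ` vanishes on their sum.
  let π : (σ → k) →ₗ[k] (σ → k) :=
    LinearMap.id - (LinearMap.toSpanSingleton k (σ → k) ((φ h)⁻¹ • h)) ∘ₗ φ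
  have hπ : ∀ c, π c = c - φ c • (φ h)⁻¹ • h := fun c => rfl
  have h1 : ∀ c, c - π c ∈ Submodule.span k {h} := fun c => by
    rw [hπ, sub_sub_cancel]
    exact Submodule.smul_mem _ _ (Submodule.smul_mem _ _ (Submodule.mem_span_singleton_self h))
  have h2 : π h = 0 := by rw [hπ, smul_smul, mul_inv_cancel₀ hφ, one_smul, sub_self]
  have h3 : f - linearSubst π f ∈ Ideal.span {linearForm k σ h} := by
    have := sub_linearSubst_mem π h1 f
    refine (?_ : linearFormIdeal (Submodule.span k {h}) ≤ _) this
    have := linearFormIdeal_sup_span (⊥ : Submodule k (σ → k)) h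
    rw [bot_sup_eq] at this
    rw [this]
    refine sup_le (Ideal.span_le.2 ?_) le_rfl
    rintro _ ⟨c, hc, rfl⟩
    rw [SetLike.mem_coe, Submodule.mem_bot] at hc
    rw [hc, map_zero]
    exact zero_mem _
  rw [← sub_add_cancel f (linearSubst π f), add_comm]
  refine Submodule.add_mem_sup (mem_linearIdealInf.2 fun i hi => ?_) h3
  have h4 := mem_linearIdealInf.1 hf i hi
  rw [linearFormIdeal_sup_span] at h4
  obtain ⟨a, ha, b, hb, rfl⟩ := Submodule.mem_sup.1 h4
  obtain ⟨b, rfl⟩ := Ideal.mem_span_singleton'.1 hb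
  rw [map_add, map_mul, linearSubst_linearForm, h2, map_zero, mul_zero, add_zero]
  refine linearSubst_mem_linearFormIdeal π (fun c hc => ?_) ha
  have : φ c = 0 := hV (Submodule.mem_iSup_of_mem i (Submodule.mem_iSup_of_mem hi hc))
  rw [hπ, this, zero_smul, sub_zero]

/-- Forms of degree at least `|T|` lift from the hyperplane section of the arrangement. -/
def LiftingProperty (W : ι → Submodule k (σ → k)) (T : Finset ι) (h : σ → k) : Prop :=
  ∀ (j : ℤ), (T.card : ℤ) ≤ j → ∀ f ∈ gradedPiece k σ j,
    f ∈ linearIdealInf (fun i => W i ⊔ Submodule.span k {h}) T →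
    f ∈ linearIdealInf W T ⊔ Ideal.span {linearForm k σ h}

theorem LiftingProperty.exists_eq {W : ι → Submodule k (σ → k)} {T : Finset ι} {h : σ → k}
    (H : LiftingProperty W T h) {j : ℤ} (hj : (T.card : ℤ) ≤ j) {f : MvPolynomial σ k}
    (hf : f ∈ gradedPiece k σ j)
    (hfT : f ∈ linearIdealInf (fun i => W i ⊔ Submodule.span k {h}) T) :
    ∃ u ∈ linearIdealInf W T, ∃ b ∈ gradedPiece k σ (j - 1), f = u + linearForm k σ h * b := by
  obtain ⟨u, hu, -, b, hb, hub⟩ := exists_of_mem_sup_span (isGradedIdeal_linearIdealInf W T)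
    (linearForm_mem h) hf (H j hj f hf hfT)
  exact ⟨u, hu, b, hb, hub⟩

/-- The sum of the dimensions of the subspaces. -/
noncomputable def dimSum (W : ι → Submodule k (σ → k)) (T : Finset ι) : ℕ :=
  ∑ i ∈ T, Module.finrank k ((σ → k) ⧸ W i)

theorem dimSum_section_lt {W : ι → Submodule k (σ → k)} {T : Finset ι} (hT : T.Nonempty)
    {h : σ → k} (hh : ∀ i ∈ T, h ∉ W i) :
    dimSum (fun i => W i ⊔ Submodule.span k {h}) T < dimSum W T := by
  refine Finset.sum_lt_sum_of_nonempty hT fun i hi => ?_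
  have h1 := Submodule.finrank_quotient_add_finrank (W i)
  have h2 := Submodule.finrank_quotient_add_finrank (W i ⊔ Submodule.span k {h})
  have h3 : W i < W i ⊔ Submodule.span k {h} := by
    refine lt_of_le_of_ne le_sup_left fun heq => hh i hi ?_
    rw [heq]
    exact Submodule.mem_sup_right (Submodule.mem_span_singleton_self h)
  have h4 := Submodule.finrank_lt_finrank_of_lt h3
  dsimp only
  omega

variable [DecidableEq ι]

/-- For `x ∈ W m` the product `x * b m` is a solution: `x * (b m - b i)` lies in the ideal of `W m`
because of `x`, and in the remaining ones because the family is compatible. Solutions add up, so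
sums of such `x` are covered. -/
theorem exists_glue_linearForm_mul {W : ι → Submodule k (σ → k)} {T : Finset ι}
    {b : ι → MvPolynomial σ k}
    (hb : ∀ i ∈ T, ∀ l ∈ T, b i - b l ∈ linearIdealInf W ((T.erase i).erase l))
    {x : σ → k} (hx : x ∈ ⨆ i ∈ T, W i) :
    ∃ c, ∀ i ∈ T, c - linearForm k σ x * b i ∈ linearIdealInf W (T.erase i) := by
  induction hx using Submodule.iSup_induction' with
  | zero => exact ⟨0, fun i _ => by simp⟩
  | add x y _ _ hx hy =>
    obtain ⟨c, hc⟩ := hx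
    obtain ⟨d, hd⟩ := hy
    refine ⟨c + d, fun i hi => ?_⟩
    rw [map_add, add_mul, add_sub_add_comm]
    exact add_mem (hc i hi) (hd i hi)
  | mem m x hx =>
    by_cases hm : m ∈ T
    · rw [iSup_pos hm] at hx
      refine ⟨linearForm k σ x * b m, fun i hi => ?_⟩
      rw [← mul_sub]
      refine mem_linearIdealInf.2 fun l hl => ?_
      by_cases hlm : l = m
      · subst hlm
        exact Ideal.mul_mem_right _ _ (linearForm_mem_linearFormIdeal hx)
      · refine Ideal.mul_mem_left _ _ (mem_linearIdealInf.1 (hb m hm i hi) l ?_)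
        rw [Finset.erase_right_comm]
        exact Finset.mem_erase.2 ⟨hlm, hl⟩
    · rw [iSup_neg hm, Submodule.mem_bot] at hx
      exact ⟨0, fun i _ => by simp [hx]⟩

/-- Compatible families of forms of degree at least `|T| - 1` glue. -/
def GluingProperty (W : ι → Submodule k (σ → k)) (T : Finset ι) : Prop :=
  ∀ (j : ℤ) (b : ι → MvPolynomial σ k), (T.card : ℤ) ≤ j + 1 →
    (∀ i ∈ T, b i ∈ gradedPiece k σ j) →
    (∀ i ∈ T, ∀ l ∈ T, b i - b l ∈ linearIdealInf W ((T.erase i).erase l)) →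
    ∃ c ∈ gradedPiece k σ j, ∀ i ∈ T, c - b i ∈ linearIdealInf W (T.erase i)

/-- The quotients after division by `h` stay compatible, because `h` is a nonzerodivisor modulo each
of the linear ideals. -/
theorem sub_mem_of_eq_add_mul {W : ι → Submodule k (σ → k)} {T : Finset ι} {h : σ → k}
    (hh : ∀ i ∈ T, h ∉ W i) {i l : ι} {f g u v b c : MvPolynomial σ k}
    (hu : u ∈ linearIdealInf W (T.erase i)) (hv : v ∈ linearIdealInf W (T.erase l))
    (hf : f = u + linearForm k σ h * b) (hg : g = v + linearForm k σ h * c)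
    (hfg : f - g ∈ linearIdealInf W ((T.erase i).erase l)) :
    b - c ∈ linearIdealInf W ((T.erase i).erase l) := by
  refine mem_linearIdealInf_of_mul_mem (h := h)
    (fun m hm => hh m (Finset.mem_of_mem_erase (Finset.mem_of_mem_erase hm))) ?_
  have : linearForm k σ h * (b - c) = (f - g) - u + v := by rw [hf, hg]; ring
  rw [this]
  refine add_mem (sub_mem hfg (linearIdealInf_anti W (Finset.erase_subset _ _) hu))
    (linearIdealInf_anti W ?_ hv)
  rw [Finset.erase_right_comm]
  exact Finset.erase_subset _ _

theorem mem_linearIdealInf_of_forall_erase {W : ι → Submodule k (σ → k)} {T : Finset ι}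
    (hT : 1 < T.card) {f : MvPolynomial σ k} (hf : ∀ i ∈ T, f ∈ linearIdealInf W (T.erase i)) :
    f ∈ linearIdealInf W T := by
  refine mem_linearIdealInf.2 fun i hi => ?_
  obtain ⟨l, hl, hli⟩ := Finset.exists_mem_ne hT i
  exact mem_linearIdealInf.1 (hf l hl) i (Finset.mem_erase.2 ⟨hli.symm, hi⟩)

/-- When the `W i` span, write `f = u i + h * b i` with `u i` in the ideal of `T \ i`. If `c` glues
the `b i`, then `f - h * c` lies in the ideal of every `T \ i`, hence in that of `T` once `T` has
two elements. The `b i` have degree one less than `f`, which is why gluing is needed from degree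
`|T| - 1` on. -/
theorem liftingProperty_of_gluingProperty {W : ι → Submodule k (σ → k)} {T : Finset ι} {h : σ → k}
    (hW : ∀ i ∈ T, W i ≠ ⊤) (hh : IsGenericForm W T h)
    (hE : ⨆ i ∈ T, W i = ⊤ → GluingProperty W T)
    (hQ : ∀ i ∈ T, LiftingProperty W (T.erase i) h) : LiftingProperty W T h := by
  intro j hj f hfj hf
  by_cases htop : ⨆ i ∈ T, W i = ⊤
  swap
  · exact mem_sup_span_of_notMem_iSup (hh T subset_rfl htop) hf
  rcases Nat.lt_or_ge 1 T.card with hT | hT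
  swap
  · rcases Nat.le_one_iff_eq_zero_or_eq_one.1 hT with hT | hT
    · rw [Finset.card_eq_zero] at hT
      subst hT
      simp [linearIdealInf]
    · obtain ⟨i, rfl⟩ := Finset.card_eq_one.1 hT
      simp only [Finset.mem_singleton, iSup_iSup_eq_left] at htop
      exact absurd htop (hW i (by simp))
  have h1 : ∀ i ∈ T, ∃ u ∈ linearIdealInf W (T.erase i), ∃ b ∈ gradedPiece k σ (j - 1),
      f = u + linearForm k σ h * b := fun i hi => by
    refine (hQ i hi).exists_eq ?_ hfj (linearIdealInf_anti _ (Finset.erase_subset _ _) hf)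
    exact le_trans (by exact_mod_cast Finset.card_le_card (Finset.erase_subset i T)) hj
  choose! u hu b hb hub using h1
  obtain ⟨c, -, hc⟩ := hE htop (j - 1) b (by linarith) hb fun i hi l hl =>
    sub_mem_of_eq_add_mul (fun i hi => hh.notMem hi (hW i hi)) (hu i hi) (hu l hl) (hub i hi)
      (hub l hl) (by simp)
  have : f = (f - linearForm k σ h * c) + linearForm k σ h * c := by ring
  rw [this]
  refine Submodule.add_mem_sup (mem_linearIdealInf_of_forall_erase hT fun i hi => ?_)
    (Ideal.mul_mem_right _ _ (Ideal.mem_span_singleton_self _))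
  have : f - linearForm k σ h * c = u i - linearForm k σ h * (c - b i) := by
    linear_combination hub i hi
  rw [this]
  exact sub_mem (hu i hi) (Ideal.mul_mem_left _ _ (hc i hi))

theorem gluingProperty_of_eq_top {W : ι → Submodule k (σ → k)} {T : Finset ι} {m : ι} (hm : m ∈ T)
    (hW : W m = ⊤) : GluingProperty W T := by
  intro j b hj hbj hb
  refine ⟨b m, hbj m hm, fun i hi => ?_⟩
  by_cases him : m = i
  · simp [him]
  -- Two distinct indices force `j ≥ 1`, so forms of degree `j` lie in the irrelevant ideal `(W m)`.
  have hT : 1 < T.card := Finset.one_lt_card.2 ⟨m, hm, i, hi, him⟩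
  refine mem_linearIdealInf.2 fun l hl => ?_
  by_cases hlm : l = m
  · subst hlm
    rw [hW]
    exact mem_linearFormIdeal_top (by omega) (sub_mem (hbj _ hm) (hbj i hi))
  · refine mem_linearIdealInf.1 (hb m hm i hi) l ?_
    rw [Finset.erase_right_comm]
    exact Finset.mem_erase.2 ⟨hlm, hl⟩

/-- A solution `c` on the section satisfies `c - b i = u i + h * b' i` by lifting for `T \ i`. The
error family `h * b' i` glues exactly, since `h` lies in the sum of the `W i`; subtracting the
result from `c` solves the original problem. -/
theorem gluingProperty_of_section {W : ι → Submodule k (σ → k)} {T : Finset ι} {h : σ → k}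
    (hW : ∀ i ∈ T, W i ≠ ⊤) (htop : ⨆ i ∈ T, W i = ⊤) (hh : IsGenericForm W T h)
    (hE : GluingProperty (fun i => W i ⊔ Submodule.span k {h}) T)
    (hQ : ∀ i ∈ T, LiftingProperty W (T.erase i) h) : GluingProperty W T := by
  intro j b hj hbj hb
  obtain ⟨c, hcj, hc⟩ := hE j b hj hbj fun i hi l hl =>
    linearIdealInf_mono (fun i => le_sup_left) _ (hb i hi l hl)
  have h1 : ∀ i ∈ T, ∃ u ∈ linearIdealInf W (T.erase i), ∃ b' ∈ gradedPiece k σ (j - 1),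
      c - b i = u + linearForm k σ h * b' := fun i hi => by
    refine (hQ i hi).exists_eq ?_ (sub_mem hcj (hbj i hi)) (hc i hi)
    rw [Finset.card_erase_of_mem hi]
    have := Finset.card_pos.2 ⟨i, hi⟩
    omega
  choose! u hu b' hb' hub using h1
  obtain ⟨c', hc'⟩ := exists_glue_linearForm_mul (W := W) (T := T) (b := b') (x := h)
    (fun i hi l hl => sub_mem_of_eq_add_mul (fun i hi => hh.notMem hi (hW i hi)) (hu i hi)
      (hu l hl) (hub i hi) (hub l hl) (by
        have : c - b i - (c - b l) = -(b i - b l) := by ring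
        rw [this]
        exact neg_mem (hb i hi l hl))) (by rw [htop]; trivial)
  -- `c'` comes without a degree, so the component of degree `j` is taken; the ideals are graded.
  refine ⟨gradedComponent k σ j (c - c'), gradedComponent_mem _ _, fun i hi => ?_⟩
  rw [← gradedComponent_of_mem (hbj i hi), ← map_sub]
  refine isGradedIdeal_linearIdealInf W _ _ ?_ j
  have : c - c' - b i = u i - (c' - linearForm k σ h * b' i) := by
    linear_combination hub i hi
  rw [this]
  exact sub_mem (hu i hi) (hc' i hi)

/-- Repeated sections lower the dimensions until some `W m` is everything, where `b m` itself glues.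
The lifting hypothesis ranges over all `W` and `h` because each step replaces `W` by its section and
picks a new generic form. -/
theorem gluingProperty_of_liftingProperty [Infinite k] {T : Finset ι}
    (hQ : ∀ (W : ι → Submodule k (σ → k)) (h : σ → k), (∀ i ∈ T, W i ≠ ⊤) → IsGenericForm W T h →
      ∀ i ∈ T, LiftingProperty W (T.erase i) h) (W : ι → Submodule k (σ → k))
    (htop : ⨆ i ∈ T, W i = ⊤) : GluingProperty W T := by
  rcases T.eq_empty_or_nonempty with rfl | hT
  · exact fun j b _ _ _ => ⟨0, zero_mem _, by simp⟩
  induction hN : dimSum W T using Nat.strong_induction_on generalizing W with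
  | _ N ih =>
    by_cases hW : ∀ i ∈ T, W i ≠ ⊤
    · obtain ⟨h, hh⟩ := exists_isGenericForm W T
      refine gluingProperty_of_section hW htop hh ?_ (hQ W h hW hh)
      refine ih _ (hN ▸ dimSum_section_lt hT fun i hi => hh.notMem hi (hW i hi)) _ ?_ rfl
      rw [eq_top_iff, ← htop]
      exact iSup₂_mono fun i _ => le_sup_left
    · push Not at hW
      obtain ⟨m, hm, hWm⟩ := hW
      exact gluingProperty_of_eq_top hm hWm

theorem liftingProperty [Infinite k] (T : Finset ι) (W : ι → Submodule k (σ → k)) (h : σ → k)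
    (hW : ∀ i ∈ T, W i ≠ ⊤) (hh : IsGenericForm W T h) : LiftingProperty W T h := by
  induction T using Finset.strongInduction generalizing W h with
  | H T ih =>
    have hQ : ∀ (W : ι → Submodule k (σ → k)) (h : σ → k), (∀ i ∈ T, W i ≠ ⊤) →
        IsGenericForm W T h → ∀ i ∈ T, LiftingProperty W (T.erase i) h := fun W h hW hh i hi =>
      ih _ (Finset.erase_ssubset hi) W h (fun l hl => hW l (Finset.mem_of_mem_erase hl))
        (hh.mono (Finset.erase_subset _ _))
    exact liftingProperty_of_gluingProperty hW hh (gluingProperty_of_liftingProperty hQ W)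
      (hQ W h hW hh)

end Lifting

/-! ### Partial resolutions and short exact sequences -/

section GradedPieces

variable {k : Type u} {σ : Type} [Field k]

variable (k σ) in
/-- A family of subgroups of a module over `S` on which `S` acts compatibly with the degrees. -/
@[ext]
structure GradedPieces (M : Type u) [AddCommGroup M] [Module (MvPolynomial σ k) M] where
  piece : ℤ → AddSubgroup M
  smul_mem' : ∀ (a j : ℤ) (f : MvPolynomial σ k) (x : M), f ∈ gradedPiece k σ a → x ∈ piece j →
    f • x ∈ piece (a + j)

variable {M N : Type u} [AddCommGroup M] [Module (MvPolynomial σ k) M]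
  [AddCommGroup N] [Module (MvPolynomial σ k) N]

theorem GradedPieces.smul_mem (ℳ : GradedPieces k σ M) {a j : ℤ} {f : MvPolynomial σ k} {x : M}
    (hf : f ∈ gradedPiece k σ a) (hx : x ∈ ℳ.piece j) : f • x ∈ ℳ.piece (a + j) :=
  ℳ.smul_mem' a j f x hf hx

theorem mem_freePiece_iff {ι : Type*} {e : ι → ℤ} {j : ℤ} {v : ι → MvPolynomial σ k} :
    v ∈ freePiece k σ e j ↔ ∀ α, v α ∈ gradedPiece k σ (j - e α) := by
  simp [freePiece, Submodule.mem_pi]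

theorem smul_mem_freePiece {ι : Type*} {e : ι → ℤ} {a j : ℤ} {f : MvPolynomial σ k}
    {v : ι → MvPolynomial σ k} (hf : f ∈ gradedPiece k σ a) (hv : v ∈ freePiece k σ e j) :
    f • v ∈ freePiece k σ e (a + j) := by
  rw [mem_freePiece_iff] at *
  intro α
  rw [add_sub_assoc]
  exact mul_mem_gradedPiece hf (hv α)

theorem single_mem_freePiece {ι : Type*} [DecidableEq ι] (e : ι → ℤ) (α : ι) :
    Pi.single α 1 ∈ freePiece k σ e (e α) := by
  rw [mem_freePiece_iff]
  intro β
  by_cases h : β = α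
  · subst h
    simpa using one_mem_gradedPiece
  · rw [Pi.single_eq_of_ne h]
    exact zero_mem _

theorem exists_freePiece_eq_zero {ι : Type*} [Finite ι] (e : ι → ℤ) :
    ∃ N : ℤ, ∀ j < N, ∀ v ∈ freePiece k σ e j, v = 0 := by
  obtain ⟨N, hN⟩ := (Set.finite_range e).bddBelow
  refine ⟨N, fun j hj v hv => funext fun α => ?_⟩
  have : N ≤ e α := hN ⟨α, rfl⟩
  exact eq_zero_of_mem_gradedPiece_neg (by omega) (mem_freePiece_iff.1 hv α)

/-- The pieces of the graded free module `⨁_α S(-e_α)`. -/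
noncomputable def freePieces {ι : Type} (e : ι → ℤ) : GradedPieces k σ (ι → MvPolynomial σ k) where
  piece j := (freePiece k σ e j).toAddSubgroup
  smul_mem' _ _ _ _ hf hx := smul_mem_freePiece hf hx

/-- The pieces of the kernel of a map from a graded free module. -/
noncomputable def kerPieces {ι : Type} (e : ι → ℤ)
    (φ : (ι → MvPolynomial σ k) →ₗ[MvPolynomial σ k] M) :
    GradedPieces k σ (ι → MvPolynomial σ k) where
  piece j := (freePiece k σ e j).toAddSubgroup ⊓ (LinearMap.ker φ).toAddSubgroup
  smul_mem' _ _ f _ hf hx :=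
    ⟨smul_mem_freePiece hf hx.1, (LinearMap.ker φ).smul_mem f hx.2⟩

theorem mem_kerPieces {ι : Type} {e : ι → ℤ}
    {φ : (ι → MvPolynomial σ k) →ₗ[MvPolynomial σ k] M} {j : ℤ} {v : ι → MvPolynomial σ k} :
    v ∈ (kerPieces e φ).piece j ↔ v ∈ freePiece k σ e j ∧ φ v = 0 := Iff.rfl

/-- The image of a family of pieces. -/
noncomputable def GradedPieces.map (ℳ : GradedPieces k σ M) (g : M →ₗ[MvPolynomial σ k] N) :
    GradedPieces k σ N where
  piece j := (ℳ.piece j).map g.toAddMonoidHom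
  smul_mem' := by
    rintro a j f _ hf ⟨x, hx, rfl⟩
    exact ⟨f • x, ℳ.smul_mem hf hx, map_smul g f x⟩

/-- The degree-preserving map `φ` from a graded free module is onto the pieces of `ℳ`. -/
structure IsCover {ι : Type*} (e : ι → ℤ) (φ : (ι → MvPolynomial σ k) →ₗ[MvPolynomial σ k] M)
    (ℳ : GradedPieces k σ M) : Prop where
  map_mem : ∀ {j : ℤ} {v : ι → MvPolynomial σ k}, v ∈ freePiece k σ e j → φ v ∈ ℳ.piece j
  exists_eq : ∀ {j : ℤ} {x : M}, x ∈ ℳ.piece j → ∃ v ∈ freePiece k σ e j, φ v = x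

/-- `ℳ` has the beginning of length `s` of a free resolution by graded free modules of finite rank
whose `i`-th term is generated in degrees at most `r + i`. -/
def RegularUpTo : ℕ → ℤ → ∀ {M : Type u} [AddCommGroup M] [Module (MvPolynomial σ k) M],
    GradedPieces k σ M → Prop
  | 0, _, _, _, _, _ => True
  | s + 1, r, M, _, _, ℳ => ∃ (ι : Type) (_ : Finite ι) (e : ι → ℤ)
      (φ : (ι → MvPolynomial σ k) →ₗ[MvPolynomial σ k] M),
      (∀ α, e α ≤ r) ∧ IsCover e φ ℳ ∧ RegularUpTo s (r + 1) (kerPieces e φ)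

/-- `0 → 𝒜 → ℬ → 𝒞 → 0` is exact in every degree. -/
structure IsPieceQuotient (𝒜 ℬ : GradedPieces k σ M) (𝒞 : GradedPieces k σ N)
    (g : M →ₗ[MvPolynomial σ k] N) : Prop where
  le : ∀ {j : ℤ} {x : M}, x ∈ 𝒜.piece j → x ∈ ℬ.piece j
  map_eq_zero : ∀ {j : ℤ} {x : M}, x ∈ 𝒜.piece j → g x = 0
  map_mem : ∀ {j : ℤ} {x : M}, x ∈ ℬ.piece j → g x ∈ 𝒞.piece j
  exists_eq : ∀ {j : ℤ} {y : N}, y ∈ 𝒞.piece j → ∃ x ∈ ℬ.piece j, g x = y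
  mem_of_eq_zero : ∀ {j : ℤ} {x : M}, x ∈ ℬ.piece j → g x = 0 → x ∈ 𝒜.piece j

theorem IsCover.isPieceQuotient {ι : Type} {e : ι → ℤ}
    {φ : (ι → MvPolynomial σ k) →ₗ[MvPolynomial σ k] M} {ℳ : GradedPieces k σ M}
    (h : IsCover e φ ℳ) : IsPieceQuotient (kerPieces e φ) (freePieces e) ℳ φ where
  le hx := hx.1
  map_eq_zero hx := hx.2
  map_mem := h.map_mem
  exists_eq := h.exists_eq
  mem_of_eq_zero hx h0 := ⟨hx, h0⟩

/-- Only homogeneous elements matter, so `g` has to be bijective on the pieces but not on the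
ambient modules. This lets submodules and quotients be represented inside convenient ambient
modules. -/
theorem RegularUpTo.congr {s : ℕ} {r : ℤ} {ℳ : GradedPieces k σ M} {𝒩 : GradedPieces k σ N}
    (h : RegularUpTo s r ℳ) (g : M →ₗ[MvPolynomial σ k] N)
    (hmem : ∀ j, ∀ x ∈ ℳ.piece j, g x ∈ 𝒩.piece j)
    (hinj : ∀ j, ∀ x ∈ ℳ.piece j, g x = 0 → x = 0)
    (hsurj : ∀ j, ∀ y ∈ 𝒩.piece j, ∃ x ∈ ℳ.piece j, g x = y) : RegularUpTo s r 𝒩 := by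
  cases s with
  | zero => trivial
  | succ s =>
    obtain ⟨ι, hι, e, φ, he, hφ, hK⟩ := h
    refine ⟨ι, hι, e, g ∘ₗ φ, he, ⟨fun hv => hmem _ _ (hφ.map_mem hv), fun {j y} hy => ?_⟩, ?_⟩
    · obtain ⟨x, hx, rfl⟩ := hsurj j y hy
      obtain ⟨v, hv, rfl⟩ := hφ.exists_eq hx
      exact ⟨v, hv, rfl⟩
    · have : kerPieces e (g ∘ₗ φ) = kerPieces e φ := by
        ext j v
        simp only [mem_kerPieces, LinearMap.comp_apply]
        exact and_congr_right fun hv =>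
          ⟨hinj j _ (hφ.map_mem hv), fun h => by rw [h, map_zero]⟩
      rwa [this]

theorem RegularUpTo.map {s : ℕ} {r : ℤ} {ℳ : GradedPieces k σ M} (h : RegularUpTo s r ℳ)
    (g : M →ₗ[MvPolynomial σ k] N) (hinj : ∀ j, ∀ x ∈ ℳ.piece j, g x = 0 → x = 0) :
    RegularUpTo s r (ℳ.map g) :=
  h.congr g (fun _ x hx => ⟨x, hx, rfl⟩) hinj fun _ _ hy => hy

theorem RegularUpTo.mono {s : ℕ} {r r' : ℤ} (hr : r ≤ r') {ℳ : GradedPieces k σ M}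
    (h : RegularUpTo s r ℳ) : RegularUpTo s r' ℳ := by
  induction s generalizing r r' M with
  | zero => trivial
  | succ s ih =>
    obtain ⟨ι, hι, e, φ, he, hφ, hK⟩ := h
    exact ⟨ι, hι, e, φ, fun α => (he α).trans hr, hφ, ih (by omega) hK⟩

theorem regularUpTo_of_eq_bot (s : ℕ) (r : ℤ) {ℳ : GradedPieces k σ M}
    (h : ∀ j, ∀ x ∈ ℳ.piece j, x = 0) : RegularUpTo s r ℳ := by
  induction s generalizing r M with
  | zero => trivial
  | succ s ih =>
    refine ⟨PEmpty, inferInstance, PEmpty.elim, 0, fun α => α.elim, ⟨fun _ => zero_mem _,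
      fun {j x} hx => ⟨0, zero_mem _, by rw [h j x hx, map_zero]⟩⟩,
      ih _ fun j x _ => Subsingleton.elim _ _⟩

theorem regularUpTo_freePieces (s : ℕ) {r : ℤ} {ι : Type} [Finite ι] {e : ι → ℤ}
    (he : ∀ α, e α ≤ r) : RegularUpTo s r (freePieces (k := k) (σ := σ) e) := by
  cases s with
  | zero => trivial
  | succ s =>
    refine ⟨ι, inferInstance, e, LinearMap.id, he, ⟨fun h => h, fun {j x} hx => ⟨x, hx, rfl⟩⟩,
      regularUpTo_of_eq_bot _ _ fun j x hx => hx.2⟩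

theorem exists_lift_freePiece {ι : Type*} [Finite ι] (e : ι → ℤ) {ℳ : GradedPieces k σ M}
    (x : ι → M)
    (hx : ∀ α, x α ∈ ℳ.piece (e α)) :
    ∃ φ : (ι → MvPolynomial σ k) →ₗ[MvPolynomial σ k] M,
      (∀ {j : ℤ} {v : ι → MvPolynomial σ k}, v ∈ freePiece k σ e j → φ v ∈ ℳ.piece j) ∧
      ∀ [DecidableEq ι] α, φ (Pi.single α 1) = x α := by
  have := Fintype.ofFinite ι
  refine ⟨Fintype.linearCombination _ x, fun {j v} hv => ?_, fun α => ?_⟩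
  · rw [Fintype.linearCombination_apply]
    refine sum_mem fun α _ => ?_
    have := ℳ.smul_mem (mem_freePiece_iff.1 hv α) (hx α)
    rwa [sub_add_cancel] at this
  · rw [Fintype.linearCombination_apply_single, one_smul]

theorem linearMap_ext_single {ι : Type*} [Finite ι] [DecidableEq ι]
    {φ ψ : (ι → MvPolynomial σ k) →ₗ[MvPolynomial σ k] M}
    (h : ∀ α, φ (Pi.single α 1) = ψ (Pi.single α 1)) : φ = ψ :=
  LinearMap.pi_ext' fun α => LinearMap.ext_ring (h α)

/-- A degree-preserving map from a free module lifts along degreewise surjections. -/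
theorem IsPieceQuotient.exists_lift {𝒜 ℬ : GradedPieces k σ M} {𝒞 : GradedPieces k σ N}
    {g : M →ₗ[MvPolynomial σ k] N} (h : IsPieceQuotient 𝒜 ℬ 𝒞 g) {ι : Type*} [Finite ι]
    {e : ι → ℤ} {φ : (ι → MvPolynomial σ k) →ₗ[MvPolynomial σ k] N}
    (hφ : ∀ {j : ℤ} {v : ι → MvPolynomial σ k}, v ∈ freePiece k σ e j → φ v ∈ 𝒞.piece j) :
    ∃ ψ : (ι → MvPolynomial σ k) →ₗ[MvPolynomial σ k] M,
      (∀ {j : ℤ} {v : ι → MvPolynomial σ k}, v ∈ freePiece k σ e j → ψ v ∈ ℬ.piece j) ∧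
      ∀ v, g (ψ v) = φ v := by
  classical
  choose x hx hgx using fun α => h.exists_eq (hφ (single_mem_freePiece e α))
  obtain ⟨ψ, hψ, hψx⟩ := exists_lift_freePiece e x hx
  refine ⟨ψ, hψ, fun v => ?_⟩
  have : g ∘ₗ ψ = φ := linearMap_ext_single fun α => by
    rw [LinearMap.comp_apply, hψx, hgx]
  exact LinearMap.congr_fun this v

theorem mem_freePiece_sum_iff {ι κ : Type*} {e : ι → ℤ} {e' : κ → ℤ} {j : ℤ}
    {v : ι ⊕ κ → MvPolynomial σ k} : v ∈ freePiece k σ (Sum.elim e e') j ↔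
      v ∘ Sum.inl ∈ freePiece k σ e j ∧ v ∘ Sum.inr ∈ freePiece k σ e' j := by
  simp [mem_freePiece_iff]

/-- Horseshoe lemma: a cover of `𝒜` and a lifted cover of `𝒞` together cover `ℬ`, and the kernels
again form a short exact sequence. -/
theorem IsPieceQuotient.regularUpTo_middle {s : ℕ} {r : ℤ} {𝒜 ℬ : GradedPieces k σ M}
    {𝒞 : GradedPieces k σ N} {g : M →ₗ[MvPolynomial σ k] N} (h : IsPieceQuotient 𝒜 ℬ 𝒞 g)
    (hA : RegularUpTo s r 𝒜) (hC : RegularUpTo s r 𝒞) : RegularUpTo s r ℬ := by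
  induction s generalizing r M N with
  | zero => trivial
  | succ s ih =>
    obtain ⟨ι, hι, e, φ, he, hφ, hK⟩ := hA
    obtain ⟨κ, hκ, e', φ', he', hφ', hK'⟩ := hC
    obtain ⟨ψ, hψ, hgψ⟩ := h.exists_lift hφ'.map_mem
    let inl : (ι → MvPolynomial σ k) →ₗ[MvPolynomial σ k] (ι ⊕ κ → MvPolynomial σ k) :=
      (LinearEquiv.sumArrowLequivProdArrow ι κ _ _).symm.toLinearMap ∘ₗ LinearMap.inl _ _ _
    have hinl : ∀ v, inl v = Sum.elim v 0 := fun v => by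
      ext (α | α) <;> simp [inl]
    let pl : (ι ⊕ κ → MvPolynomial σ k) →ₗ[MvPolynomial σ k] (ι → MvPolynomial σ k) :=
      LinearMap.funLeft _ _ Sum.inl
    let pr : (ι ⊕ κ → MvPolynomial σ k) →ₗ[MvPolynomial σ k] (κ → MvPolynomial σ k) :=
      LinearMap.funLeft _ _ Sum.inr
    have hpl : ∀ v, pl v = v ∘ Sum.inl := fun v => rfl
    have hpr : ∀ v, pr v = v ∘ Sum.inr := fun v => rfl
    have hpinl : ∀ v, pl (inl v) = v ∧ pr (inl v) = 0 := fun v => by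
      rw [hinl, hpl, hpr]; exact ⟨Sum.elim_comp_inl _ _, Sum.elim_comp_inr _ _⟩
    let Φ : (ι ⊕ κ → MvPolynomial σ k) →ₗ[MvPolynomial σ k] M := φ ∘ₗ pl + ψ ∘ₗ pr
    have hΦ : ∀ v, Φ v = φ (pl v) + ψ (pr v) := fun v => rfl
    have hmem : ∀ {j v}, v ∈ freePiece k σ (Sum.elim e e') j ↔
        pl v ∈ freePiece k σ e j ∧ pr v ∈ freePiece k σ e' j := mem_freePiece_sum_iff
    refine ⟨ι ⊕ κ, inferInstance, Sum.elim e e', Φ, by rintro (α | α) <;> simp [he, he'],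
      ⟨fun {j v} hv => ?_, fun {j x} hx => ?_⟩, ?_⟩
    · rw [hmem] at hv
      exact add_mem (h.le (hφ.map_mem hv.1)) (hψ hv.2)
    · obtain ⟨w, hw, hwx⟩ := hφ'.exists_eq (h.map_mem hx)
      have h0 : g (x - ψ w) = 0 := by rw [map_sub, hgψ, hwx, sub_self]
      obtain ⟨v, hv, hvx⟩ := hφ.exists_eq (h.mem_of_eq_zero (sub_mem hx (hψ hw)) h0)
      refine ⟨Sum.elim v w, hmem.2 ⟨hv, hw⟩, ?_⟩
      rw [hΦ]
      change φ v + ψ w = x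
      rw [hvx, sub_add_cancel]
    · refine ih (𝒜 := (kerPieces e φ).map inl) (𝒞 := kerPieces e' φ') (g := pr)
        ⟨?_, ?_, ?_, ?_, ?_⟩
        (hK.map inl fun j x _ h0 => by rw [← (hpinl x).1, h0, map_zero]) hK'
      · rintro j _ ⟨v, hv, rfl⟩
        refine ⟨hmem.2 ?_, ?_⟩
        · change pl (inl v) ∈ _ ∧ pr (inl v) ∈ _
          rw [(hpinl v).1, (hpinl v).2]
          exact ⟨hv.1, zero_mem _⟩
        · change Φ (inl v) = 0
          rw [hΦ, (hpinl v).1, (hpinl v).2, map_zero, add_zero]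
          exact hv.2
      · rintro j _ ⟨v, hv, rfl⟩
        exact (hpinl v).2
      · rintro j v ⟨hv, h0⟩
        refine ⟨(hmem.1 hv).2, ?_⟩
        change φ' (pr v) = 0
        have h0 : φ (pl v) + ψ (pr v) = 0 := h0
        rw [← hgψ, eq_neg_of_add_eq_zero_right h0, map_neg,
          h.map_eq_zero (hφ.map_mem (hmem.1 hv).1), neg_zero]
      · rintro j w ⟨hw, h0⟩
        have h0 : φ' w = 0 := h0
        obtain ⟨v, hv, hvw⟩ := hφ.exists_eq
          (h.mem_of_eq_zero (hψ hw) ((hgψ w).trans h0))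
        refine ⟨Sum.elim (-v) w, ⟨hmem.2 ⟨?_, hw⟩, ?_⟩, rfl⟩
        · exact neg_mem hv
        · change φ (-v) + ψ w = 0
          rw [map_neg, hvw, neg_add_cancel]
      · rintro j v ⟨hv, h0⟩ hv0
        have h0 : φ (pl v) + ψ (pr v) = 0 := h0
        rw [hv0, map_zero, add_zero] at h0
        refine ⟨pl v, ⟨(hmem.1 hv).1, h0⟩, ?_⟩
        change inl (pl v) = v
        rw [hinl]
        ext (α | α)
        · rfl
        · exact congrArg _ (congrFun hv0.symm α)

/-- A cover `φ` of `ℬ` also covers `𝒞`, and the new kernel is an extension of `𝒜` by the kernel of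
`φ`. -/
theorem IsPieceQuotient.regularUpTo_right {s : ℕ} {r : ℤ} {𝒜 ℬ : GradedPieces k σ M}
    {𝒞 : GradedPieces k σ N} {g : M →ₗ[MvPolynomial σ k] N} (h : IsPieceQuotient 𝒜 ℬ 𝒞 g)
    (hA : RegularUpTo s (r + 1) 𝒜) (hB : RegularUpTo (s + 1) r ℬ) : RegularUpTo (s + 1) r 𝒞 := by
  obtain ⟨ι, hι, e, φ, he, hφ, hK⟩ := hB
  refine ⟨ι, hι, e, g ∘ₗ φ, he, ⟨fun hv => h.map_mem (hφ.map_mem hv), fun {j y} hy => ?_⟩, ?_⟩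
  · obtain ⟨x, hx, rfl⟩ := h.exists_eq hy
    obtain ⟨v, hv, rfl⟩ := hφ.exists_eq hx
    exact ⟨v, hv, rfl⟩
  · refine IsPieceQuotient.regularUpTo_middle (g := φ) (𝒜 := kerPieces e φ) (𝒞 := 𝒜)
      ⟨?_, ?_, ?_, ?_, ?_⟩ hK hA
    · rintro j v ⟨hv, h0⟩
      refine ⟨hv, ?_⟩
      change g (φ v) = 0
      rw [show φ v = 0 from h0, map_zero]
    · exact fun hv => hv.2
    · rintro j v ⟨hv, h0⟩
      exact h.mem_of_eq_zero (hφ.map_mem hv) h0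
    · intro j x hx
      obtain ⟨v, hv, rfl⟩ := hφ.exists_eq (h.le hx)
      exact ⟨v, ⟨hv, h.map_eq_zero hx⟩, rfl⟩
    · rintro j v ⟨hv, -⟩ h0
      exact ⟨hv, h0⟩

theorem IsPieceQuotient.regularUpTo_left {s : ℕ} {r : ℤ} {𝒜 ℬ : GradedPieces k σ M}
    {𝒞 : GradedPieces k σ N} {g : M →ₗ[MvPolynomial σ k] N} (h : IsPieceQuotient 𝒜 ℬ 𝒞 g)
    (hB : RegularUpTo s (r + 1) ℬ) (hC : RegularUpTo (s + 1) r 𝒞) :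
    RegularUpTo s (r + 1) 𝒜 := by
  cases s with
  | zero => trivial
  | succ s =>
  obtain ⟨ι, hι, e, φ, he, hφ, hK⟩ := hC
  obtain ⟨ψ, hψ, hgψ⟩ := h.exists_lift hφ.map_mem
  -- The pullback of `ℬ → 𝒞` along a cover `F → 𝒞`. It is an extension of `ℬ` by the kernel of the
  -- cover. Since the cover lifts to `ψ`, the graph of `ψ` is a copy of `F` in it with quotient `𝒜`.
  let 𝒟 : GradedPieces k σ (M × (ι → MvPolynomial σ k)) :=
    { piece := fun j =>
        { carrier := {p | p.1 ∈ ℬ.piece j ∧ p.2 ∈ freePiece k σ e j ∧ g p.1 = φ p.2}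
          zero_mem' := ⟨zero_mem _, zero_mem _, by simp⟩
          add_mem' := fun {p q} hp hq => ⟨add_mem hp.1 hq.1, add_mem hp.2.1 hq.2.1, by
            simp only [Prod.fst_add, Prod.snd_add, map_add, hp.2.2, hq.2.2]⟩
          neg_mem' := fun {p} hp => ⟨neg_mem hp.1, neg_mem hp.2.1, by
            simp only [Prod.fst_neg, Prod.snd_neg, map_neg, hp.2.2]⟩ }
      smul_mem' := fun a j f p hf hp =>
        ⟨ℬ.smul_mem hf hp.1, smul_mem_freePiece hf hp.2.1, by
          simp only [Prod.smul_fst, Prod.smul_snd, map_smul, hp.2.2]⟩ }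
  have hP : RegularUpTo (s + 1) (r + 1) 𝒟 := by
    refine IsPieceQuotient.regularUpTo_middle (g := LinearMap.fst _ _ _)
      (𝒜 := (kerPieces e φ).map (LinearMap.inr _ _ _)) (𝒞 := ℬ) ⟨?_, ?_, ?_, ?_, ?_⟩
      (hK.map _ fun j x _ h0 => (Prod.mk.inj h0).2) hB
    · rintro j _ ⟨v, hv, rfl⟩
      exact ⟨zero_mem _, hv.1, (map_zero g).trans (Eq.symm hv.2)⟩
    · rintro j _ ⟨v, hv, rfl⟩
      rfl
    · exact fun hp => hp.1
    · intro j x hx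
      obtain ⟨v, hv, hvx⟩ := hφ.exists_eq (h.map_mem hx)
      exact ⟨(x, v), ⟨hx, hv, hvx.symm⟩, rfl⟩
    · rintro j ⟨x, v⟩ ⟨hx, hv, hxv⟩ h0
      have h0 : x = 0 := h0
      subst h0
      exact ⟨v, ⟨hv, hxv.symm.trans (map_zero g)⟩, rfl⟩
  let i : (ι → MvPolynomial σ k) →ₗ[MvPolynomial σ k] M × (ι → MvPolynomial σ k) :=
    ψ.prod LinearMap.id
  refine IsPieceQuotient.regularUpTo_right (𝒜 := (freePieces e).map i) (ℬ := 𝒟)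
    (g := LinearMap.fst _ _ _ - ψ ∘ₗ LinearMap.snd _ _ _) ⟨?_, ?_, ?_, ?_, ?_⟩
    (RegularUpTo.map (regularUpTo_freePieces s fun α => by linarith [he α]) i
      fun j x _ h0 => (Prod.mk.inj h0).2) hP
  · rintro j _ ⟨v, hv, rfl⟩
    exact ⟨hψ hv, hv, hgψ v⟩
  · rintro j _ ⟨v, hv, rfl⟩
    exact sub_self (ψ v)
  · rintro j ⟨x, v⟩ ⟨hx, hv, hxv⟩
    refine h.mem_of_eq_zero (sub_mem hx (hψ hv)) ?_
    change g (x - ψ v) = 0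
    rw [map_sub, hgψ]
    exact sub_eq_zero.2 hxv
  · intro j x hx
    refine ⟨(x, 0), ⟨h.le hx, zero_mem _, ?_⟩, ?_⟩
    · exact (h.map_eq_zero hx).trans (map_zero φ).symm
    · change x - ψ 0 = x
      rw [map_zero, sub_zero]
  · rintro j ⟨x, v⟩ ⟨hx, hv, hxv⟩ h0
    refine ⟨v, hv, ?_⟩
    have h0 : x - ψ v = 0 := h0
    exact Prod.ext (sub_eq_zero.1 h0).symm rfl

/-- Regularity can be tested modulo a linear form that is a nonzerodivisor. -/
theorem regularUpTo_of_quotient {s : ℕ} {r : ℤ} {ℳ : GradedPieces k σ M} {𝒩 : GradedPieces k σ N}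
    {g : M →ₗ[MvPolynomial σ k] N} {h : MvPolynomial σ k} (hh : h ∈ gradedPiece k σ 1)
    (h0 : h ≠ 0) (hmem : ∀ {j x}, x ∈ ℳ.piece j → g x ∈ 𝒩.piece j)
    (hsurj : ∀ {j y}, y ∈ 𝒩.piece j → ∃ x ∈ ℳ.piece j, g x = y)
    (hzero : ∀ {j x}, x ∈ ℳ.piece j → g (h • x) = 0)
    (hker : ∀ {j x}, x ∈ ℳ.piece j → g x = 0 → ∃ y ∈ ℳ.piece (j - 1), x = h • y)
    (hinj : ∀ {j x}, x ∈ ℳ.piece j → h • x = 0 → x = 0)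
    (hbdd : ∃ B : ℤ, ∀ j < B, ∀ x ∈ ℳ.piece j, x = 0) (hN : RegularUpTo s r 𝒩) :
    RegularUpTo s r ℳ := by
  induction s generalizing r M N with
  | zero => trivial
  | succ s ih =>
    obtain ⟨ι, hι, e, φ, he, hφ, hK⟩ := hN
    have hsmul : ∀ {j x}, x ∈ ℳ.piece (j - 1) → h • x ∈ ℳ.piece j := fun {j x} hx => by
      simpa using ℳ.smul_mem hh hx
    have hsmulF : ∀ {j v}, v ∈ freePiece k σ e (j - 1) → h • v ∈ freePiece k σ e j :=
      fun {j x} hx => by simpa using smul_mem_freePiece hh hx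
    have hdiv : ∀ {j} {v : ι → MvPolynomial σ k}, h • v ∈ freePiece k σ e j →
        v ∈ freePiece k σ e (j - 1) := fun {j v} hv => by
      rw [mem_freePiece_iff] at *
      intro α
      refine mem_of_mul_mem_gradedPiece hh h0 ?_
      have := hv α
      rwa [show 1 + (j - 1 - e α) = j - e α by ring]
    have hinjF : ∀ v : ι → MvPolynomial σ k, h • v = 0 → v = 0 := fun v hv =>
      (smul_eq_zero.1 hv).resolve_left h0
    let 𝒬 : GradedPieces k σ M :=
      { piece := fun j => (ℳ.piece j) ⊓ (LinearMap.ker g).toAddSubgroup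
        smul_mem' := fun a j f x hf hx =>
          ⟨ℳ.smul_mem hf hx.1, (LinearMap.ker g).smul_mem f hx.2⟩ }
    have hQ : IsPieceQuotient 𝒬 ℳ 𝒩 g :=
      ⟨fun hx => hx.1, fun hx => hx.2, hmem, hsurj, fun hx h0 => ⟨hx, h0⟩⟩
    obtain ⟨ψ, hψ, hgψ⟩ := hQ.exists_lift hφ.map_mem
    obtain ⟨B, hB⟩ := hbdd
    have hcover : IsCover e ψ ℳ := by
      refine ⟨hψ, ?_⟩
      -- Graded Nakayama: modulo the image of `ψ`, an element is `h` times one of lower degree, and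
      -- the degrees are bounded below.
      have key : ∀ n : ℕ, ∀ j < B + n, ∀ x ∈ ℳ.piece j, ∃ v ∈ freePiece k σ e j, ψ v = x := by
        intro n
        induction n with
        | zero =>
          intro j hj x hx
          exact ⟨0, zero_mem _, by rw [hB j (by simpa using hj) x hx, map_zero]⟩
        | succ n ihn =>
          intro j hj x hx
          obtain ⟨w, hw, hwx⟩ := hφ.exists_eq (hmem hx)
          obtain ⟨y, hy, hxy⟩ := hker (sub_mem hx (hψ hw))
            (by rw [map_sub, hgψ, hwx, sub_self])
          obtain ⟨v, hv, rfl⟩ := ihn (j - 1) (by push_cast at hj; omega) y hy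
          exact ⟨w + h • v, add_mem hw (hsmulF hv), by
            rw [map_add, map_smul, ← hxy, add_sub_cancel]⟩
      intro j x hx
      exact key (j - B + 1).toNat j (by omega) x hx
    refine ⟨ι, hι, e, ψ, he, hcover, ?_⟩
    let mh : (ι → MvPolynomial σ k) →ₗ[MvPolynomial σ k] (ι → MvPolynomial σ k) :=
      LinearMap.lsmul _ _ h
    let q := (LinearMap.range mh).mkQ
    have hq : ∀ v, q v = 0 ↔ ∃ w, h • w = v := fun v => by
      change (LinearMap.range mh).mkQ v = 0 ↔ _
      rw [Submodule.mkQ_apply, Submodule.Quotient.mk_eq_zero]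
      rfl
    have hhK : ∀ {j v}, v ∈ freePiece k σ e (j - 1) → h • v ∈ (kerPieces e φ).piece j := by
      intro j v hv
      refine ⟨hsmulF hv, ?_⟩
      change φ (h • v) = 0
      rw [← hgψ, map_smul, hzero (hψ hv)]
    -- This is `ker φ / hF`, where `hF` is free with generators in degrees at most `r + 1`. It is
    -- also `ker ψ / h ker ψ`, to which the induction hypothesis applies.
    have hC : RegularUpTo s (r + 1) ((kerPieces e φ).map q) := by
      cases s with
      | zero => trivial
      | succ s =>
      have hfree : ∀ {j} {v : ι → MvPolynomial σ k},
          v ∈ freePiece k σ (fun α => e α + 1) j ↔ v ∈ freePiece k σ e (j - 1) := by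
        intro j v
        simp only [mem_freePiece_iff, sub_add_eq_sub_sub_swap]
      refine IsPieceQuotient.regularUpTo_right (g := q) (ℬ := kerPieces e φ)
        (𝒜 := (freePieces fun α => e α + 1).map mh) ⟨?_, ?_, ?_, ?_, ?_⟩
        (RegularUpTo.map (regularUpTo_freePieces s fun α => by linarith [he α]) mh
          fun j x _ hx => hinjF x hx) hK
      · rintro j _ ⟨v, hv, rfl⟩
        exact hhK (hfree.1 hv)
      · rintro j _ ⟨v, hv, rfl⟩
        exact (hq _).2 ⟨v, rfl⟩
      · exact fun {j x} hx => ⟨x, hx, rfl⟩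
      · exact fun hy => hy
      · intro j v hv hqv
        obtain ⟨w, rfl⟩ := (hq v).1 hqv
        exact ⟨w, hfree.2 (hdiv hv.1), rfl⟩
    refine ih (g := q) ?_ ?_ ?_ ?_ ?_ ?_ hC
    · rintro j v ⟨hv, hv0⟩
      refine ⟨v, ⟨hv, ?_⟩, rfl⟩
      change φ v = 0
      rw [← hgψ, show ψ v = 0 from hv0, map_zero]
    · rintro j _ ⟨v, ⟨hv, hv0⟩, rfl⟩
      have hv0 : φ v = 0 := hv0
      obtain ⟨y, hy, hvy⟩ := hker (hψ hv) ((hgψ v).trans hv0)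
      obtain ⟨w, hw, rfl⟩ := hcover.exists_eq hy
      refine ⟨v - h • w, ⟨(freePiece k σ e j).sub_mem hv (hsmulF hw), ?_⟩, ?_⟩
      · change ψ (v - h • w) = 0
        rw [map_sub, map_smul, hvy, sub_self]
      · change q (v - h • w) = q v
        rw [map_sub, (hq _).2 ⟨w, rfl⟩, sub_zero]
    · exact fun {j v} _ => (hq _).2 ⟨v, rfl⟩
    · rintro j v ⟨hv, hv0⟩ hqv
      obtain ⟨w, rfl⟩ := (hq v).1 hqv
      refine ⟨w, ⟨hdiv hv, ?_⟩, rfl⟩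
      have hv0 : ψ (h • w) = 0 := hv0
      rw [map_smul] at hv0
      exact hinj (hψ (hdiv hv)) hv0
    · exact fun {j v} _ => hinjF v
    · obtain ⟨N, hN⟩ := exists_freePiece_eq_zero (k := k) (σ := σ) e
      exact ⟨N, fun j hj v hv => hN j hj v hv.1⟩

end GradedPieces

/-! ### Regularity of graded ideals and the main induction -/

section IdealPieces

variable {k : Type u} {σ : Type} [Field k]

/-- The pieces `I ∩ S_j` of an ideal `I`. -/
noncomputable def idealPieces (I : Ideal (MvPolynomial σ k)) :
    GradedPieces k σ (MvPolynomial σ k) where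
  piece j := (gradedPiece k σ j).toAddSubgroup ⊓ I.toAddSubgroup
  smul_mem' _ _ f _ hf hx := ⟨mul_mem_gradedPiece hf hx.1, I.mul_mem_left f hx.2⟩

variable (k σ) in
/-- The pieces of `S(-t)`. -/
noncomputable def twistPieces (t : ℤ) : GradedPieces k σ (MvPolynomial σ k) where
  piece j := (gradedPiece k σ (j - t)).toAddSubgroup
  smul_mem' a j f x hf hx := by
    rw [add_sub_assoc]
    exact mul_mem_gradedPiece hf hx

theorem regularUpTo_twistPieces (s : ℕ) {t r : ℤ} (ht : t ≤ r) :
    RegularUpTo s r (twistPieces k σ t) := by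
  refine (regularUpTo_freePieces s (e := fun _ : Unit => t) fun _ => ht).congr
    (LinearMap.proj ()) (fun j v hv => mem_freePiece_iff.1 hv ())
    (fun j v _ h => funext fun _ => h)
    fun j f hf => ⟨fun _ => f, mem_freePiece_iff.2 fun _ => hf, rfl⟩

/-- `ℳ` has partial resolutions of every length with generators in degrees at most `r + i`. -/
def RegularPieces {M : Type u} [AddCommGroup M] [Module (MvPolynomial σ k) M] (r : ℤ)
    (ℳ : GradedPieces k σ M) : Prop :=
  ∀ s, RegularUpTo s r ℳ

theorem regularPieces_top : RegularPieces 0 (idealPieces (⊤ : Ideal (MvPolynomial σ k))) :=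
  fun s => (regularUpTo_twistPieces s le_rfl).congr LinearMap.id
    (fun j f hf => ⟨by simpa using (show f ∈ gradedPiece k σ (j - 0) from hf), trivial⟩)
    (fun _ _ _ h => h)
    fun j f hf => ⟨f, show f ∈ gradedPiece k σ (j - 0) by simpa using hf.1, rfl⟩

variable [Fintype σ]

theorem linearFormIdeal_bot : linearFormIdeal (⊥ : Submodule k (σ → k)) = ⊥ := by
  simp [linearFormIdeal]

/-- For `h ∉ W`, multiplication by `h` is injective on `S/(W)` with cokernel `S/(W + h)`, and its
source is shifted by one degree. -/
theorem regularUpTo_sup_span (W : Submodule k (σ → k)) (h : σ → k)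
    (H : ∀ s t, RegularUpTo s t ((twistPieces k σ t).map (linearFormIdeal W).mkQ)) (s : ℕ) (t : ℤ) :
    RegularUpTo s t ((twistPieces k σ t).map
      (linearFormIdeal (W ⊔ Submodule.span k {h})).mkQ) := by
  by_cases hh : h ∈ W
  · have : W ⊔ Submodule.span k {h} = W := by simpa using hh
    rw [this]
    exact H s t
  cases s with
  | zero => trivial
  | succ s =>
  have hI : linearFormIdeal W ≤ linearFormIdeal (W ⊔ Submodule.span k {h}) :=
    linearFormIdeal_mono le_sup_left
  let mh : (MvPolynomial σ k ⧸ linearFormIdeal W) →ₗ[MvPolynomial σ k]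
      (MvPolynomial σ k ⧸ linearFormIdeal W) := LinearMap.lsmul _ _ (linearForm k σ h)
  refine IsPieceQuotient.regularUpTo_right (g := Submodule.factor hI)
    (ℬ := (twistPieces k σ t).map (linearFormIdeal W).mkQ)
    (𝒜 := ((twistPieces k σ (t + 1)).map (linearFormIdeal W).mkQ).map mh) ⟨?_, ?_, ?_, ?_, ?_⟩
    ((H s (t + 1)).map mh ?_) (H (s + 1) t)
  · rintro j _ ⟨_, ⟨f, hf, rfl⟩, rfl⟩
    refine ⟨linearForm k σ h * f, ?_, rfl⟩
    have := mul_mem_gradedPiece (linearForm_mem h) hf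
    rwa [show 1 + (j - (t + 1)) = j - t by ring] at this
  · rintro j _ ⟨_, ⟨f, hf, rfl⟩, rfl⟩
    change (linearFormIdeal (W ⊔ Submodule.span k {h})).mkQ (linearForm k σ h * f) = 0
    rw [Submodule.mkQ_apply, Submodule.Quotient.mk_eq_zero]
    exact Ideal.mul_mem_right _ _ (linearForm_mem_linearFormIdeal
      (Submodule.mem_sup_right (Submodule.mem_span_singleton_self h)))
  · rintro j _ ⟨f, hf, rfl⟩
    exact ⟨f, hf, rfl⟩
  · rintro j _ ⟨f, hf, rfl⟩
    exact ⟨_, ⟨f, hf, rfl⟩, rfl⟩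
  · rintro j _ ⟨f, hf, rfl⟩ h0
    change (linearFormIdeal (W ⊔ Submodule.span k {h})).mkQ f = 0 at h0
    rw [Submodule.mkQ_apply, Submodule.Quotient.mk_eq_zero, linearFormIdeal_sup_span] at h0
    obtain ⟨u, hu, -, b, hb, rfl⟩ := exists_of_mem_sup_span (isGradedIdeal_linearFormIdeal W)
      (linearForm_mem h) hf h0
    refine ⟨_, ⟨b, ?_, rfl⟩, ?_⟩
    · rwa [show j - t - 1 = j - (t + 1) by ring] at hb
    · change (linearFormIdeal W).mkQ (linearForm k σ h * b) = (linearFormIdeal W).mkQ _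
      rw [map_add, Submodule.mkQ_apply _ u, (Submodule.Quotient.mk_eq_zero _).2 hu, zero_add]
  · rintro j _ ⟨f, hf, rfl⟩ h0
    change (linearFormIdeal W).mkQ (linearForm k σ h * f) = 0 at h0
    change (linearFormIdeal W).mkQ f = 0
    rw [Submodule.mkQ_apply, Submodule.Quotient.mk_eq_zero] at h0 ⊢
    exact mem_linearFormIdeal_of_mul_mem hh h0

/-- Quotients of `S` by linear forms have linear resolutions. -/
theorem regularUpTo_quotient_linearFormIdeal (W : Submodule k (σ → k)) (s : ℕ) (t : ℤ) :
    RegularUpTo s t ((twistPieces k σ t).map (linearFormIdeal W).mkQ) := by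
  classical
  obtain ⟨T, rfl⟩ : W.FG := IsNoetherian.noetherian W
  induction T using Finset.induction_on generalizing s t with
  | empty =>
    rw [Finset.coe_empty, Submodule.span_empty]
    refine (regularUpTo_twistPieces s le_rfl).map _ fun j f _ h0 => ?_
    rwa [Submodule.mkQ_apply, Submodule.Quotient.mk_eq_zero, linearFormIdeal_bot] at h0
  | insert h T _ ih =>
    rw [Finset.coe_insert, Submodule.span_insert, sup_comm]
    exact regularUpTo_sup_span _ h ih s t

/-- The quotient `(A + (f))/A` is a copy of `k(-t)`, which has a linear resolution starting in
degree `t ≤ r - 1`. As the right-hand term of a short exact sequence it may be one step less regular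
than allowed for the kernel `A`, whence `t < r`. -/
theorem regularPieces_of_sup_span {A : Ideal (MvPolynomial σ k)} (hA : IsGradedIdeal A) {r t : ℤ}
    (htr : t < r) {f : MvPolynomial σ k} (hf : f ∈ gradedPiece k σ t) (hfA : f ∉ A)
    (hmul : ∀ c, linearForm k σ c * f ∈ A)
    (h : RegularPieces r (idealPieces (A ⊔ Ideal.span {f}))) : RegularPieces r (idealPieces A) := by
  intro s
  have hmul' : ∀ g ∈ linearFormIdeal (⊤ : Submodule k (σ → k)), g * f ∈ A := by
    have : linearFormIdeal (⊤ : Submodule k (σ → k)) ≤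
        LinearMap.ker (LinearMap.toSpanSingleton _ _ (A.mkQ f)) := by
      refine Ideal.span_le.2 ?_
      rintro _ ⟨c, -, rfl⟩
      change A.mkQ (linearForm k σ c * f) = 0
      rw [Submodule.mkQ_apply, Submodule.Quotient.mk_eq_zero]
      exact hmul c
    intro g hg
    have h0 : A.mkQ (g * f) = 0 := this hg
    rwa [Submodule.mkQ_apply, Submodule.Quotient.mk_eq_zero] at h0
  let φ : (MvPolynomial σ k ⧸ linearFormIdeal (⊤ : Submodule k (σ → k))) →ₗ[MvPolynomial σ k]
      (MvPolynomial σ k ⧸ A) := (linearFormIdeal (⊤ : Submodule k (σ → k))).liftQ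
    (LinearMap.toSpanSingleton _ _ (A.mkQ f)) fun g hg => by
      change A.mkQ (g * f) = 0
      rw [Submodule.mkQ_apply, Submodule.Quotient.mk_eq_zero]
      exact hmul' g hg
  have hC : RegularUpTo (s + 1) t ((idealPieces (A ⊔ Ideal.span {f})).map A.mkQ) := by
    refine (regularUpTo_quotient_linearFormIdeal ⊤ (s + 1) t).congr φ ?_ ?_ ?_
    · rintro j _ ⟨g, hg, rfl⟩
      refine ⟨g * f, ⟨?_, Ideal.mul_mem_left _ _
        (Submodule.mem_sup_right (Ideal.mem_span_singleton_self f))⟩, rfl⟩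
      have := mul_mem_gradedPiece hg hf
      rwa [sub_add_cancel] at this
    · rintro j _ ⟨g, hg, rfl⟩ h0
      change A.mkQ (g * f) = 0 at h0
      change (linearFormIdeal (⊤ : Submodule k (σ → k))).mkQ g = 0
      rw [Submodule.mkQ_apply, Submodule.Quotient.mk_eq_zero] at h0 ⊢
      change g ∈ gradedPiece k σ (j - t) at hg
      rcases lt_trichotomy (j - t) 0 with hj | hj | hj
      · rw [eq_zero_of_mem_gradedPiece_neg hj hg]
        exact zero_mem _
      · rw [hj] at hg
        rw [eq_C_of_mem_gradedPiece_zero hg] at h0 ⊢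
        have : coeff 0 g = 0 := by
          by_contra hne
          apply hfA
          have := A.mul_mem_left (C (coeff 0 g)⁻¹) h0
          rwa [← mul_assoc, ← C_mul, inv_mul_cancel₀ hne, C_1, one_mul] at this
        rw [this, C_0]
        exact zero_mem _
      · exact mem_linearFormIdeal_top hj hg
    · rintro j _ ⟨g, ⟨hg, hgA⟩, rfl⟩
      obtain ⟨u, hu, -, b, hb, rfl⟩ := exists_of_mem_sup_span hA hf hg hgA
      refine ⟨_, ⟨b, hb, rfl⟩, ?_⟩
      change A.mkQ (b * f) = A.mkQ (u + f * b)
      rw [map_add, Submodule.mkQ_apply _ u, (Submodule.Quotient.mk_eq_zero _).2 hu, zero_add,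
        mul_comm]
  have hq : IsPieceQuotient (idealPieces A) (idealPieces (A ⊔ Ideal.span {f}))
      ((idealPieces (A ⊔ Ideal.span {f})).map A.mkQ) A.mkQ := by
    refine ⟨fun hx => ⟨hx.1, Submodule.mem_sup_left hx.2⟩, fun hx => ?_,
      fun {j x} hx => ⟨x, hx, rfl⟩, fun hy => hy, fun hx h0 => ⟨hx.1, ?_⟩⟩
    · rw [Submodule.mkQ_apply, Submodule.Quotient.mk_eq_zero]
      exact hx.2
    · rwa [Submodule.mkQ_apply, Submodule.Quotient.mk_eq_zero] at h0
  have := hq.regularUpTo_left (s := s) (r := r - 1) (by rw [sub_add_cancel]; exact h s)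
    (hC.mono (by omega))
  rwa [sub_add_cancel] at this

/-- Ideals that agree in degrees at least `r` with a larger `r`-regular ideal are `r`-regular. -/
theorem regularPieces_of_le {r : ℤ} {A B : Ideal (MvPolynomial σ k)} (hA : IsGradedIdeal A)
    (hB : IsGradedIdeal B) (hAB : A ≤ B)
    (h : ∀ j ≥ r, ∀ f ∈ gradedPiece k σ j, f ∈ B → f ∈ A) (hreg : RegularPieces r (idealPieces B)) :
    RegularPieces r (idealPieces A) := by
  induction A using WellFoundedGT.induction with
  | _ A ih =>
    by_cases hBA : B ≤ A
    · rwa [le_antisymm hAB hBA]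
    let P : ℤ → Prop := fun t => ∃ f ∈ gradedPiece k σ t, f ∈ B ∧ f ∉ A
    have hbdd : ∀ t, P t → t ≤ r := fun t ⟨f, hf, hfB, hfA⟩ => by
      by_contra hlt
      exact hfA (h t (by omega) f hf hfB)
    have hne : ∃ t, P t := by
      by_contra hcon
      push Not at hcon
      refine hBA fun f hf => ?_
      obtain ⟨N, hN⟩ := exists_sum_gradedComponent f
      rw [hN N le_rfl]
      refine sum_mem fun i _ => ?_
      by_contra hi
      exact hcon i ⟨_, gradedComponent_mem _ _, hB f hf i, hi⟩
    -- An element of top degree in `B` outside `A` is a socle element of `B/A`; adjoining it to `A`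
    -- allows Noetherian induction.
    obtain ⟨t, ⟨f, hf, hfB, hfA⟩, hmax⟩ := Int.exists_greatest_of_bdd ⟨r, hbdd⟩ hne
    have htr : t < r := by
      by_contra hlt
      exact hfA (h t (by omega) f hf hfB)
    refine regularPieces_of_sup_span hA htr hf hfA (fun c => ?_) (ih _ ?_ (hA.sup_span hf) ?_ ?_)
    · by_contra hcon
      have := hmax (1 + t) ⟨_, mul_mem_gradedPiece (linearForm_mem c) hf,
        B.mul_mem_left _ hfB, hcon⟩
      omega
    · refine lt_of_le_of_ne le_sup_left fun heq => hfA ?_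
      rw [heq]
      exact Submodule.mem_sup_right (Ideal.mem_span_singleton_self f)
    · exact sup_le hAB ((Ideal.span_singleton_le_iff_mem _).2 hfB)
    · exact fun j hj g hg hgB => Submodule.mem_sup_left (h j hj g hg hgB)

/-- Regularity of a graded ideal from that of the ideal of its hyperplane section. -/
theorem regularPieces_of_hyperplane {J : Ideal (MvPolynomial σ k)} (hJ : IsGradedIdeal J) {r : ℤ}
    (hr : 0 ≤ r) {h : σ → k} (h0 : h ≠ 0) (hdiv : ∀ f, linearForm k σ h * f ∈ J → f ∈ J)
    (hreg : RegularPieces r (idealPieces (J ⊔ Ideal.span {linearForm k σ h}))) :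
    RegularPieces r (idealPieces J) := by
  intro s
  cases s with
  | zero => trivial
  | succ s =>
  set x := linearForm k σ h with hx
  have hx0 : x ≠ 0 := by rwa [hx, Ne, map_eq_zero_iff _ linearForm_injective]
  have hx1 : x ∈ gradedPiece k σ 1 := linearForm_mem h
  let q := (Ideal.span {x}).mkQ
  have hq : ∀ f, q f = 0 ↔ f ∈ Ideal.span {x} := fun f => by
    change (Ideal.span {x}).mkQ f = 0 ↔ _
    rw [Submodule.mkQ_apply, Submodule.Quotient.mk_eq_zero]
  let mx : MvPolynomial σ k →ₗ[MvPolynomial σ k] MvPolynomial σ k := LinearMap.lsmul _ _ x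
  have hmx : ∀ f, q (x * f) = 0 := fun f =>
    (hq _).2 (Ideal.mul_mem_right _ _ (Ideal.mem_span_singleton_self x))
  -- `J/xJ` is isomorphic to `(J + (x))/(x)`. Here `(x)` is free on a generator of degree `1 ≤ r +
  -- 1`, which is where `0 ≤ r` enters.
  have hN : RegularUpTo (s + 1) r ((idealPieces (J ⊔ Ideal.span {x})).map q) := by
    refine IsPieceQuotient.regularUpTo_right (g := q) (𝒜 := (twistPieces k σ 1).map mx)
      ⟨?_, ?_, fun {j f} hf => ⟨f, hf, rfl⟩, fun hy => hy, ?_⟩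
      ((regularUpTo_twistPieces s (by omega)).map mx fun j f _ hf =>
        (mul_eq_zero.1 hf).resolve_left hx0) (hreg (s + 1))
    · rintro j _ ⟨f, hf, rfl⟩
      refine ⟨?_, Submodule.mem_sup_right
        (Ideal.mul_mem_right _ _ (Ideal.mem_span_singleton_self x))⟩
      have := mul_mem_gradedPiece hx1 hf
      rwa [add_sub_cancel] at this
    · rintro j _ ⟨f, hf, rfl⟩
      exact hmx f
    · rintro j f ⟨hf, -⟩ hf0
      obtain ⟨b, rfl⟩ := Ideal.mem_span_singleton.1 ((hq f).1 hf0)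
      refine ⟨b, mem_of_mul_mem_gradedPiece hx1 hx0 ?_, rfl⟩
      rwa [add_sub_cancel]
  refine regularUpTo_of_quotient (g := q) hx1 hx0 ?_ ?_ ?_ ?_ ?_ ?_ hN
  · exact fun {j f} hf => ⟨f, ⟨hf.1, Submodule.mem_sup_left hf.2⟩, rfl⟩
  · rintro j _ ⟨f, ⟨hf, hfJ⟩, rfl⟩
    obtain ⟨u, hu, huj, b, hb, rfl⟩ := exists_of_mem_sup_span hJ hx1 hf hfJ
    refine ⟨u, ⟨huj, hu⟩, ?_⟩
    change q u = q (u + x * b)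
    rw [map_add, hmx, add_zero]
  · exact fun {j f} _ => hmx f
  · rintro j f ⟨hf, hfJ⟩ hf0
    obtain ⟨b, rfl⟩ := Ideal.mem_span_singleton.1 ((hq f).1 hf0)
    refine ⟨b, ⟨mem_of_mul_mem_gradedPiece hx1 hx0 ?_, hdiv b hfJ⟩, rfl⟩
    rwa [add_sub_cancel]
  · exact fun {j f} _ hf => (mul_eq_zero.1 hf).resolve_left hx0
  · exact ⟨0, fun j hj f hf => eq_zero_of_mem_gradedPiece_neg hj hf.1⟩

variable {ι : Type*} [DecidableEq ι]

/-- The irrelevant ideal contains all forms of positive degree, so dropping it changes nothing in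
degrees at least `|T| ≥ 1`. -/
theorem regularPieces_of_eq_top {W : ι → Submodule k (σ → k)} {T : Finset ι} {i : ι} (hi : i ∈ T)
    (hW : W i = ⊤)
    (ih : RegularPieces ((T.erase i).card : ℤ) (idealPieces (linearIdealInf W (T.erase i)))) :
    RegularPieces (T.card : ℤ) (idealPieces (linearIdealInf W T)) := by
  have hcard := Finset.card_pos.2 ⟨i, hi⟩
  refine regularPieces_of_le (isGradedIdeal_linearIdealInf W T)
    (isGradedIdeal_linearIdealInf W (T.erase i)) (linearIdealInf_anti W (Finset.erase_subset _ _))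
    (fun j hj f hf hfT => mem_linearIdealInf.2 fun l hl => ?_)
    fun s => (ih s).mono (by exact_mod_cast Finset.card_le_card (Finset.erase_subset i T))
  by_cases hli : l = i
  · rw [hli, hW]
    exact mem_linearFormIdeal_top (by omega) hf
  · exact mem_linearIdealInf.1 hfT l (Finset.mem_erase.2 ⟨hli, hl⟩)

theorem regularPieces_linearIdealInf [Infinite k] (T : Finset ι) (W : ι → Submodule k (σ → k)) :
    RegularPieces (T.card : ℤ) (idealPieces (linearIdealInf W T)) := by
  induction T using Finset.strongInduction generalizing W with
  | H T ihT =>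
  rcases T.eq_empty_or_nonempty with rfl | hT
  · have : linearIdealInf W ∅ = ⊤ := by simp [linearIdealInf]
    rw [this]
    exact regularPieces_top
  induction hN : dimSum W T using Nat.strong_induction_on generalizing W with
  | _ N ih =>
    by_cases hW : ∀ i ∈ T, W i ≠ ⊤
    · obtain ⟨h, hh⟩ := exists_isGenericForm W T
      have hnot : ∀ i ∈ T, h ∉ W i := fun i hi => hh.notMem hi (hW i hi)
      obtain ⟨i, hi⟩ := hT
      refine regularPieces_of_hyperplane (isGradedIdeal_linearIdealInf W T) (by positivity)
        (h := h) (fun h0 => hnot i hi (by rw [h0]; exact zero_mem _))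
        (fun f => mem_linearIdealInf_of_mul_mem hnot) ?_
      refine regularPieces_of_le ((isGradedIdeal_linearIdealInf W T).sup_span (linearForm_mem h))
        (isGradedIdeal_linearIdealInf _ T) ?_ (liftingProperty T W h hW hh)
        (ih _ (hN ▸ dimSum_section_lt ⟨i, hi⟩ hnot) _ rfl)
      refine sup_le (linearIdealInf_mono (fun _ => le_sup_left) T) ?_
      rw [Ideal.span_singleton_le_iff_mem]
      exact mem_linearIdealInf.2 fun i _ => linearForm_mem_linearFormIdeal
        (Submodule.mem_sup_right (Submodule.mem_span_singleton_self h))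
    · push Not at hW
      obtain ⟨i, hi, hWi⟩ := hW
      exact regularPieces_of_eq_top hi hWi (ihT _ (Finset.erase_ssubset hi) W)

end IdealPieces

/-! ### Homogeneous components in graded free modules -/

section FreeComponent

variable {k σ ι : Type*} [Field k]

variable (k σ) in
/-- The projection of a graded free module onto its degree `j` piece. -/
noncomputable def freeComponent (e : ι → ℤ) (j : ℤ) :
    (ι → MvPolynomial σ k) →ₗ[k] (ι → MvPolynomial σ k) :=
  LinearMap.pi fun α => gradedComponent k σ (j - e α) ∘ₗ LinearMap.proj α

theorem freeComponent_apply (e : ι → ℤ) (j : ℤ) (v : ι → MvPolynomial σ k) (α : ι) :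
    freeComponent k σ e j v α = gradedComponent k σ (j - e α) (v α) := rfl

theorem freeComponent_mem (e : ι → ℤ) (j : ℤ) (v : ι → MvPolynomial σ k) :
    freeComponent k σ e j v ∈ freePiece k σ e j := by
  simp only [freePiece, Submodule.mem_pi]
  exact fun α _ => gradedComponent_mem _ _

theorem freeComponent_of_mem {e : ι → ℤ} {j : ℤ} {v : ι → MvPolynomial σ k}
    (hv : v ∈ freePiece k σ e j) : freeComponent k σ e j v = v :=
  funext fun α => gradedComponent_of_mem (Submodule.mem_pi.1 hv α trivial)

theorem freeComponent_of_mem_of_ne {e : ι → ℤ} {i j : ℤ} (hij : i ≠ j) {v : ι → MvPolynomial σ k}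
    (hv : v ∈ freePiece k σ e i) : freeComponent k σ e j v = 0 :=
  funext fun α => gradedComponent_of_mem_of_ne (by omega) (Submodule.mem_pi.1 hv α trivial)

theorem exists_sum_freeComponent [Finite ι] (e : ι → ℤ) (v : ι → MvPolynomial σ k) :
    ∃ s : Finset ℤ, v = ∑ j ∈ s, freeComponent k σ e j v := by
  have := Fintype.ofFinite ι
  -- Large enough that every monomial of every `v α`, shifted by `e α`, has degree between `-N` and
  -- `N`.
  let N : ℕ := ∑ α, ((e α).natAbs + (v α).totalDegree)
  refine ⟨Finset.Icc (-(N : ℤ)) N, ?_⟩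
  ext α m
  have hN : (e α).natAbs + (v α).totalDegree ≤ N :=
    Finset.single_le_sum (f := fun α => (e α).natAbs + (v α).totalDegree)
      (fun _ _ => Nat.zero_le _) (Finset.mem_univ α)
  rw [Finset.sum_apply, coeff_sum]
  simp only [freeComponent_apply, coeff_gradedComponent, eq_sub_iff_add_eq, Finset.sum_ite_eq,
    Finset.mem_Icc]
  split_ifs with h
  · rfl
  · by_contra hne
    have := le_totalDegree (mem_support_iff.2 hne)
    change m.degree ≤ _ at this
    omega

end FreeComponent

/-! ### Assembling a minimal graded free resolution -/

section MinimalResolution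

variable {k : Type u} {σ : Type} [Field k]
variable {M : Type u} [AddCommGroup M] [Module (MvPolynomial σ k) M]

/-- The structure `GradedPieces` does not require the pieces to be independent. The maps `c j`,
projections to degree `j`, supply this, so that kernels are graded and exactness on pieces gives
exactness. -/
theorem map_freeComponent_eq_zero {ι : Type*} [Finite ι] {e : ι → ℤ} {ℳ : GradedPieces k σ M}
    {φ : (ι → MvPolynomial σ k) →ₗ[MvPolynomial σ k] M}
    (hφ : ∀ {j v}, v ∈ freePiece k σ e j → φ v ∈ ℳ.piece j) (c : ℤ → M →+ M)
    (hc : ∀ j, ∀ x ∈ ℳ.piece j, c j x = x) (hc' : ∀ i j, i ≠ j → ∀ x ∈ ℳ.piece i, c j x = 0)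
    {v : ι → MvPolynomial σ k} (hv : φ v = 0) (j : ℤ) : φ (freeComponent k σ e j v) = 0 := by
  obtain ⟨s, hs⟩ := exists_sum_freeComponent e v
  have h1 : φ (freeComponent k σ e j v) = c j (φ v) := by
    conv_lhs => rw [hs]
    conv_rhs => rw [hs]
    simp only [map_sum]
    refine Finset.sum_congr rfl fun i _ => ?_
    have hi := freeComponent_mem e i v
    by_cases hij : i = j
    · subst hij
      rw [freeComponent_of_mem hi, hc _ _ (hφ hi)]
    · rw [freeComponent_of_mem_of_ne hij hi, map_zero, hc' i j hij _ (hφ hi)]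
  rw [h1, hv, map_zero]

theorem IsCover.exact {ι : Type} {κ : Type*} [Finite ι] [Finite κ] {e : ι → ℤ} {e' : κ → ℤ}
    {ℳ : GradedPieces k σ M} {φ : (ι → MvPolynomial σ k) →ₗ[MvPolynomial σ k] M}
    {ψ : (κ → MvPolynomial σ k) →ₗ[MvPolynomial σ k] (ι → MvPolynomial σ k)}
    (hψ : IsCover e' ψ (kerPieces e φ))
    (hφ : ∀ {j v}, v ∈ freePiece k σ e j → φ v ∈ ℳ.piece j) (c : ℤ → M →+ M)
    (hc : ∀ j, ∀ x ∈ ℳ.piece j, c j x = x) (hc' : ∀ i j, i ≠ j → ∀ x ∈ ℳ.piece i, c j x = 0) :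
    Function.Exact ψ φ := by
  intro v
  constructor
  · intro hv
    choose w _ hw' using fun j => hψ.exists_eq (j := j) (x := freeComponent k σ e j v)
      ⟨freeComponent_mem e j v, map_freeComponent_eq_zero hφ c hc hc' hv j⟩
    obtain ⟨s, hs⟩ := exists_sum_freeComponent e v
    refine ⟨∑ j ∈ s, w j, ?_⟩
    rw [map_sum, hs]
    exact Finset.sum_congr rfl fun j _ => hw' j
  · rintro ⟨w, rfl⟩
    obtain ⟨s, hs⟩ := exists_sum_freeComponent e' w
    rw [hs, map_sum, map_sum]
    exact Finset.sum_eq_zero fun j _ => (hψ.map_mem (freeComponent_mem e' j w)).2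

theorem eq_linearCombination {ι : Type*} [Fintype ι] [DecidableEq ι]
    (φ : (ι → MvPolynomial σ k) →ₗ[MvPolynomial σ k] M) :
    φ = Fintype.linearCombination (MvPolynomial σ k) fun α => φ (Pi.single α 1) :=
  linearMap_ext_single fun α => by
    rw [Fintype.linearCombination_apply_single, one_smul]

theorem IsCover.exists_fin {ι : Type*} [Finite ι] {e : ι → ℤ} {r : ℤ} (he : ∀ α, e α ≤ r)
    {φ : (ι → MvPolynomial σ k) →ₗ[MvPolynomial σ k] M} {ℳ : GradedPieces k σ M}
    (h : IsCover e φ ℳ) : ∃ (m : ℕ) (e' : Fin m → ℤ)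
      (ψ : (Fin m → MvPolynomial σ k) →ₗ[MvPolynomial σ k] M),
      (∀ α, e' α ≤ r) ∧ IsCover e' ψ ℳ := by
  obtain ⟨m, ⟨g⟩⟩ := Finite.exists_equiv_fin ι
  refine ⟨m, e ∘ g.symm, φ ∘ₗ LinearMap.funLeft _ _ g, fun α => he _,
    ⟨fun {j v} hv => h.map_mem ?_, fun {j x} hx => ?_⟩⟩
  · rw [mem_freePiece_iff] at *
    intro α
    simpa using hv (g α)
  · obtain ⟨v, hv, rfl⟩ := h.exists_eq hx
    refine ⟨v ∘ g.symm, ?_, ?_⟩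
    · rw [mem_freePiece_iff] at *
      exact fun α => hv _
    · rw [LinearMap.comp_apply]
      congr 1
      ext1 α
      simp [LinearMap.funLeft]

/-- A syzygy with a unit entry expresses the generator `β` through the others: a suitable multiple
of `v` clears the coordinate `β` without changing the image. -/
theorem IsCover.exists_remove {m : ℕ} {e : Fin (m + 1) → ℤ} {r : ℤ} (he : ∀ α, e α ≤ r)
    {φ : (Fin (m + 1) → MvPolynomial σ k) →ₗ[MvPolynomial σ k] M} {ℳ : GradedPieces k σ M}
    (h : IsCover e φ ℳ) {v : Fin (m + 1) → MvPolynomial σ k} {β : Fin (m + 1)} {c : k} (hc : c ≠ 0)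
    (hv : v ∈ freePiece k σ e (e β)) (hφv : φ v = 0) (hvβ : v β = C c) :
    ∃ (e' : Fin m → ℤ) (ψ : (Fin m → MvPolynomial σ k) →ₗ[MvPolynomial σ k] M),
      (∀ α, e' α ≤ r) ∧ IsCover e' ψ ℳ := by
  obtain ⟨ψ, hψ, hψx⟩ := exists_lift_freePiece (e ∘ β.succAbove)
    (fun α => φ (Pi.single (β.succAbove α) 1)) (fun α => h.map_mem (single_mem_freePiece e _))
  refine ⟨e ∘ β.succAbove, ψ, fun α => he _, ⟨hψ, fun {j x} hx => ?_⟩⟩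
  obtain ⟨w, hw, rfl⟩ := h.exists_eq hx
  let w' := w - (C c⁻¹ * w β) • v
  have hw' : w' ∈ freePiece k σ e j := by
    refine sub_mem hw ?_
    have := smul_mem_freePiece (mul_mem_gradedPiece (C_mem_gradedPiece c⁻¹)
      (mem_freePiece_iff.1 hw β)) hv
    rwa [zero_add, sub_add_cancel] at this
  have hwβ : w' β = 0 := by
    have : (C c⁻¹ * C c : MvPolynomial σ k) = 1 := by rw [← C_mul, inv_mul_cancel₀ hc, C_1]
    simp only [w', Pi.sub_apply, Pi.smul_apply, smul_eq_mul, hvβ]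
    linear_combination -(w β) * this
  refine ⟨w' ∘ β.succAbove, ?_, ?_⟩
  · rw [mem_freePiece_iff] at *
    exact fun α => hw' _
  · have h1 : φ w' = φ w := by simp [w', hφv]
    rw [← h1, eq_linearCombination φ, eq_linearCombination ψ, Fintype.linearCombination_apply,
      Fintype.linearCombination_apply, Fin.sum_univ_succAbove _ β, hwβ, zero_smul, zero_add]
    exact Finset.sum_congr rfl fun α _ => by rw [hψx]; rfl

variable [Fintype σ]

/-- In a cover of least rank no homogeneous syzygy has a unit entry, since that generator could be
removed. The kernel keeps the regularity bound for any cover in degrees at most `r`, not just for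
the one in the given partial resolution. -/
theorem exists_minimal_cover {r : ℤ} {ℳ : GradedPieces k σ M} (hℳ : RegularPieces r ℳ) :
    ∃ (m : ℕ) (e : Fin m → ℤ) (φ : (Fin m → MvPolynomial σ k) →ₗ[MvPolynomial σ k] M),
      (∀ α, e α ≤ r) ∧ IsCover e φ ℳ ∧ RegularPieces (r + 1) (kerPieces e φ) ∧
      ∀ j, ∀ v ∈ (kerPieces e φ).piece j, ∀ β,
        v β ∈ Ideal.span (Set.range (X : σ → MvPolynomial σ k)) := by
  classical
  have hex : ∃ m : ℕ, ∃ (e : Fin m → ℤ)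
      (φ : (Fin m → MvPolynomial σ k) →ₗ[MvPolynomial σ k] M), (∀ α, e α ≤ r) ∧ IsCover e φ ℳ := by
    obtain ⟨ι, hι, e, φ, he, hφ, -⟩ := hℳ 1
    exact hφ.exists_fin he
  obtain ⟨e, φ, he, hφ⟩ := Nat.find_spec hex
  have hmin := fun n => Nat.find_min (m := n) hex
  generalize Nat.find hex = m at e φ hmin
  refine ⟨m, e, φ, he, hφ, fun s => ?_, ?_⟩
  · exact hφ.isPieceQuotient.regularUpTo_left
      (regularUpTo_freePieces s fun α => (he α).trans (by omega)) (hℳ (s + 1))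
  · rintro j v ⟨hv, hφv⟩ β
    have hβ := mem_freePiece_iff.1 hv β
    rcases lt_trichotomy (j - e β) 0 with hj | hj | hj
    · rw [eq_zero_of_mem_gradedPiece_neg hj hβ]
      exact zero_mem _
    · rw [hj] at hβ
      by_cases hc : coeff 0 (v β) = 0
      · rw [eq_C_of_mem_gradedPiece_zero hβ, hc, C_0]
        exact zero_mem _
      · obtain rfl : j = e β := by omega
        cases m with
        | zero => exact β.elim0
        | succ m =>
          exact absurd (hφ.exists_remove he hc hv hφv (eq_C_of_mem_gradedPiece_zero hβ))
            (hmin m (Nat.lt_succ_self m))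
    · exact mem_span_X_of_mem_gradedPiece hj hβ

variable (k σ) in
/-- A free module in a minimal resolution together with the syzygies it contains. -/
structure SyzygyStage where
  bound : ℤ
  rank : ℕ
  deg : Fin rank → ℤ
  syzygies : GradedPieces k σ (Fin rank → MvPolynomial σ k)
  regular : RegularPieces bound syzygies
  le : ∀ j, ∀ v ∈ syzygies.piece j, v ∈ freePiece k σ deg j
  minimal : ∀ j, ∀ v ∈ syzygies.piece j, ∀ β,
    v β ∈ Ideal.span (Set.range (X : σ → MvPolynomial σ k))

theorem SyzygyStage.exists_next (s : SyzygyStage k σ) :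
    ∃ (t : SyzygyStage k σ) (φ : (Fin t.rank → MvPolynomial σ k) →ₗ[MvPolynomial σ k]
      (Fin s.rank → MvPolynomial σ k)), t.bound = s.bound + 1 ∧ (∀ α, t.deg α ≤ s.bound) ∧
      IsCover t.deg φ s.syzygies ∧ t.syzygies = kerPieces t.deg φ := by
  obtain ⟨m, e, φ, he, hφ, hreg, hmin⟩ := exists_minimal_cover s.regular
  exact ⟨⟨s.bound + 1, m, e, kerPieces e φ, hreg, fun _ _ hv => hv.1, hmin⟩, φ, rfl, he, hφ, rfl⟩

theorem idealIsRegular_of_regularPieces {I : Ideal (MvPolynomial σ k)} (hI : IsGradedIdeal I)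
    {r : ℤ} (h : RegularPieces r (idealPieces I)) : IdealIsRegular I r := by
  classical
  obtain ⟨m, e, φ, he, hφ, hreg, hmin⟩ := exists_minimal_cover h
  let s₀ : SyzygyStage k σ := ⟨r + 1, m, e, kerPieces e φ, hreg, fun _ _ hv => hv.1, hmin⟩
  choose next d hbound hdeg hcover hsyz using SyzygyStage.exists_next (k := k) (σ := σ)
  let F : ℕ → SyzygyStage k σ := fun i => Nat.rec s₀ (fun _ s => next s) i
  -- The bound of stage `i` concerns the syzygies inside `F_i`, hence the generators of `F_{i+1}`.
  have hFbound : ∀ i, (F i).bound = r + i + 1 := fun i => by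
    induction i with
    | zero => simp [F, s₀]
    | succ i ih =>
      change (next (F i)).bound = _
      rw [hbound, ih]
      push_cast
      ring
  have hφI : ∀ v, φ v ∈ I := fun v => by
    rw [eq_linearCombination φ, Fintype.linearCombination_apply]
    exact sum_mem fun α _ => I.mul_mem_left _ (hφ.map_mem (single_mem_freePiece e α)).2
  have hsyz' : ∀ i : ℕ, (F (i + 1)).syzygies = kerPieces (F (i + 1)).deg (d (F i)) :=
    fun i => hsyz (F i)
  refine ⟨{
    rank := fun i => (F i).rank
    deg := fun i => (F i).deg
    diff := fun i => d (F i)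
    aug := φ.codRestrict I hφI
    diff_graded := fun i j v hv => (F i).le j _ ((hcover (F i)).map_mem hv)
    aug_graded := fun j v hv => (hφ.map_mem hv).1
    aug_surjective := ?_
    exact_zero := ?_
    exact_succ := ?_
    minimal := ?_ }, ?_⟩
  · rintro ⟨f, hf⟩
    choose w _ hw' using fun j : ℤ => hφ.exists_eq (j := j) (x := gradedComponent k σ j f)
      ⟨gradedComponent_mem j f, hI f hf j⟩
    obtain ⟨N, hN⟩ := exists_sum_gradedComponent f
    refine ⟨∑ i ∈ Finset.range N, w i, Subtype.ext ?_⟩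
    rw [LinearMap.codRestrict_apply, map_sum]
    refine Eq.trans ?_ (hN N le_rfl).symm
    exact Finset.sum_congr rfl fun i _ => hw' i
  · have hex : Function.Exact (d s₀) φ := IsCover.exact (hcover s₀) hφ.map_mem
      (fun j => (gradedComponent k σ j).toAddMonoidHom) (fun j x hx => gradedComponent_of_mem hx.1)
      fun i j hij x hx => gradedComponent_of_mem_of_ne hij hx.1
    intro v
    refine Iff.trans ?_ (hex v)
    rw [← Subtype.coe_inj]
    rfl
  · intro i
    have hc := hcover (F (i + 1))
    rw [hsyz' i] at hc
    exact IsCover.exact hc (ℳ := freePieces (F i).deg)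
      (fun hv => (F i).le _ _ ((hcover (F i)).map_mem hv))
      (fun j => (freeComponent k σ (F i).deg j).toAddMonoidHom)
      (fun j x hx => freeComponent_of_mem hx) fun i j hij x hx => freeComponent_of_mem_of_ne hij hx
  · intro i v β
    change d (F i) v β ∈ _
    obtain ⟨s, hs⟩ := exists_sum_freeComponent (F (i + 1)).deg v
    rw [hs, map_sum, Finset.sum_apply]
    exact sum_mem fun j _ =>
      (F i).minimal j _ ((hcover (F i)).map_mem (freeComponent_mem _ j v)) β
  · intro i α
    cases i with
    | zero =>
      change e α ≤ r + ((0 : ℕ) : ℤ)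
      simpa using he α
    | succ i =>
      have := hdeg (F i) α
      rw [hFbound] at this
      change (F (i + 1)).deg α ≤ _
      push_cast
      rw [← add_assoc]
      exact this

end MinimalResolution

/-! ### Sharpness for lines meeting a common line -/

section Sharpness

variable {k V : Type*} [Field k] [AddCommGroup V] [Module k V]

theorem exists_mem_forall_notMem [Infinite k] (A : Submodule k V) (s : Finset (Submodule k V))
    (hs : ∀ B ∈ s, ¬ A ≤ B) : ∃ q ∈ A, ∀ B ∈ s, q ∉ B := by
  classical
  let s' : Finset (Submodule k A) := s.image fun B => B.comap A.subtype
  have hs' : ⊤ ∉ s' := by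
    intro h
    obtain ⟨B, hB, htop⟩ := Finset.mem_image.1 h
    refine hs B hB fun x hx => ?_
    have : (⟨x, hx⟩ : A) ∈ B.comap A.subtype := by rw [htop]; trivial
    exact this
  obtain ⟨q, hq⟩ := (Set.ne_univ_iff_exists_notMem _).1
    (Subspace.biUnion_ne_univ_of_top_notMem hs')
  refine ⟨q, q.2, fun B hB hqB => hq ?_⟩
  simp only [Set.mem_iUnion]
  exact ⟨_, Finset.mem_image_of_mem _ hB, hqB⟩

theorem exists_eq_smul_add_smul {A : Submodule k V} (hA : Module.finrank k A = 2) {q w v : V}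
    (hq : q ∈ A) (hq0 : q ≠ 0) (hw : w ∈ A) (hqw : w ∉ Submodule.span k {q}) (hv : v ∈ A) :
    ∃ a b : k, v = a • q + b • w := by
  have : FiniteDimensional k A := Module.finite_of_finrank_eq_succ hA
  have hle : Submodule.span k {q} ⊔ Submodule.span k {w} ≤ A :=
    sup_le ((Submodule.span_singleton_le_iff_mem _ _).2 hq)
      ((Submodule.span_singleton_le_iff_mem _ _).2 hw)
  have hlt : Submodule.span k {q} < Submodule.span k {q} ⊔ Submodule.span k {w} := by
    refine lt_of_le_of_ne le_sup_left fun heq => hqw ?_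
    rw [heq]
    exact Submodule.mem_sup_right (Submodule.mem_span_singleton_self w)
  have : FiniteDimensional k ↥(Submodule.span k {q} ⊔ Submodule.span k {w}) :=
    Submodule.finiteDimensional_of_le hle
  have h1 := Submodule.finrank_lt_finrank_of_lt hlt
  rw [finrank_span_singleton hq0] at h1
  rw [← Submodule.eq_of_le_of_finrank_le hle (by omega)] at hv
  obtain ⟨_, hx, _, hy, rfl⟩ := Submodule.mem_sup.1 hv
  obtain ⟨a, rfl⟩ := Submodule.mem_span_singleton.1 hx
  obtain ⟨b, rfl⟩ := Submodule.mem_span_singleton.1 hy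
  exact ⟨a, b, rfl⟩

/-- Restricted to the line `q + t • w`, the polynomial has degree less than `d` in `t` and `d`
distinct roots. -/
theorem eval_eq_zero_of_roots_on_line {σ : Type*} {d : ℕ} {f : MvPolynomial σ k}
    (hf : f.totalDegree < d) (q w : σ → k) (s : Fin d → k) (hs : Function.Injective s)
    (h : ∀ i, aeval (q + s i • w) f = 0) : aeval q f = 0 := by
  let P : Polynomial k := aeval (fun i => Polynomial.C (q i) + Polynomial.C (w i) * Polynomial.X) f
  have hP : ∀ t, P.eval t = aeval (q + t • w) f := fun t => by
    have : (Polynomial.aeval t).comp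
        (aeval (fun i => Polynomial.C (q i) + Polynomial.C (w i) * Polynomial.X)) =
        aeval (R := k) (q + t • w) := by
      refine MvPolynomial.algHom_ext fun i => ?_
      rw [AlgHom.comp_apply, aeval_X, aeval_X, map_add, map_mul, Polynomial.aeval_C,
        Polynomial.aeval_C, Polynomial.aeval_X, Pi.add_apply, Pi.smul_apply, smul_eq_mul,
        mul_comm t]
      rfl
    exact DFunLike.congr_fun this f
  have hdeg : P.natDegree ≤ f.totalDegree * 1 :=
    MvPolynomial.aeval_natDegree_le f le_rfl _ fun i => by compute_degree
  have hP0 : P = 0 := Polynomial.eq_zero_of_natDegree_lt_card_of_eval_eq_zero P hs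
    (fun i => by rw [hP, h]) (by rw [Fintype.card_fin]; omega)
  simpa [hP0] using (hP 0).symm

variable {n d : ℕ}

theorem LinesMeetingLine.exists_point [Infinite k] {A : LinearSubspace k n}
    {L : Fin d → LinearSubspace k n} (h : LinesMeetingLine A L) :
    ∃ q : Fin (n + 1) → k, (∀ i, q ∉ Projectivization.Subspace.submodule (L i)) ∧
      ∀ f ∈ arrangementIdeal L, f.totalDegree < d → aeval q f = 0 := by
  classical
  obtain ⟨hA, hL, p, hp, hpA⟩ := h
  have hnle : ∀ i, ¬ Projectivization.Subspace.submodule A ≤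
      Projectivization.Subspace.submodule (L i) := fun i hle => by
    refine (hL i).2 (Projectivization.Subspace.submodule.injective
      (Submodule.eq_of_le_of_finrank_le hle ?_).symm)
    rw [(hL i).1, hA]
  -- Including `⊥` among the avoided subspaces forces `q ≠ 0`, also for `d = 0`.
  obtain ⟨q, hqA, hq⟩ := exists_mem_forall_notMem (Projectivization.Subspace.submodule A)
    (insert ⊥ (Finset.univ.image fun i => Projectivization.Subspace.submodule (L i))) (by
      intro B hB hle
      rcases Finset.mem_insert.1 hB with rfl | hB
      · rw [le_bot_iff] at hle
        have : Module.finrank k (Projectivization.Subspace.submodule A) = 2 := hA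
        rw [hle, finrank_bot] at this
        omega
      · obtain ⟨i, -, rfl⟩ := Finset.mem_image.1 hB
        exact hnle i hle)
  have hq0 : q ≠ 0 := fun h0 => hq ⊥ (Finset.mem_insert_self _ _) (by simp [h0])
  have hqL : ∀ i, q ∉ Projectivization.Subspace.submodule (L i) := fun i =>
    hq _ (Finset.mem_insert_of_mem (Finset.mem_image_of_mem _ (Finset.mem_univ i)))
  obtain ⟨w, hwA, hw⟩ := exists_mem_forall_notMem (Projectivization.Subspace.submodule A)
    (insert (Submodule.span k {q})
      (Finset.univ.image fun i => Projectivization.Subspace.submodule (L i))) (by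
      intro B hB hle
      rcases Finset.mem_insert.1 hB with rfl | hB
      · have := Submodule.finrank_mono hle
        rw [finrank_span_singleton hq0, hA] at this
        omega
      · obtain ⟨i, -, rfl⟩ := Finset.mem_image.1 hB
        exact hnle i hle)
  have hwq := hw _ (Finset.mem_insert_self _ _)
  have hwL : ∀ i, w ∉ Projectivization.Subspace.submodule (L i) := fun i =>
    hw _ (Finset.mem_insert_of_mem (Finset.mem_image_of_mem _ (Finset.mem_univ i)))
  have hrepA : ∀ i, (p i).rep ∈ Projectivization.Subspace.submodule A := fun i => by
    rw [Projectivization.Subspace.mem_submodule_iff _ (p i).rep_nonzero, (p i).mk_rep]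
    exact (hpA i).2
  have hrepL : ∀ i, (p i).rep ∈ Projectivization.Subspace.submodule (L i) := fun i => by
    rw [Projectivization.Subspace.mem_submodule_iff _ (p i).rep_nonzero, (p i).mk_rep]
    exact (hpA i).1
  choose a b hab using fun i => exists_eq_smul_add_smul hA hqA hq0 hwA hwq (hrepA i)
  -- The second basis vector `w` of `A` avoids every `L i`, so no `p i` is the point at infinity of
  -- the chart `q + t • w`; its parameter is `b i / a i`.
  have ha : ∀ i, a i ≠ 0 := fun i h0 => by
    have h1 := hab i
    rw [h0, zero_smul, zero_add] at h1
    have hb : b i ≠ 0 := fun hb => (p i).rep_nonzero (by rw [h1, hb, zero_smul])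
    refine hwL i ?_
    have := Submodule.smul_mem _ (b i)⁻¹ (hrepL i)
    rwa [h1, inv_smul_smul₀ hb] at this
  have hpt : ∀ i, q + (b i / a i) • w = (a i)⁻¹ • (p i).rep := fun i => by
    rw [hab i, smul_add, inv_smul_smul₀ (ha i), smul_smul, div_eq_inv_mul]
  refine ⟨q, hqL, fun f hf hdeg => eval_eq_zero_of_roots_on_line hdeg q w (fun i => b i / a i)
    (fun i l hil => ?_) fun i => ?_⟩
  · have h1 : (a i)⁻¹ • (p i).rep = (a l)⁻¹ • (p l).rep := by
      rw [← hpt, ← hpt]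
      dsimp only at hil
      rw [hil]
    apply hp
    rw [← (p i).mk_rep, ← (p l).mk_rep, Projectivization.mk_eq_mk_iff' k _ _ _ _]
    refine ⟨a i * (a l)⁻¹, ?_⟩
    rw [mul_smul, ← h1, smul_inv_smul₀ (ha i)]
  · rw [hpt]
    exact (Submodule.mem_iInf _).1 hf i _ (Submodule.smul_mem _ _ (hrepL i))

/-- If `r < d`, all generators have degree less than `d` and vanish at a point `q` of `A` off the
lines, so the whole ideal does. A product of linear forms, one vanishing on each `L i` but not at
`q`, contradicts this. -/
theorem LinesMeetingLine.le_of_isRegular [Infinite k] {A : LinearSubspace k n}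
    {L : Fin d → LinearSubspace k n} (h : LinesMeetingLine A L) {r : ℤ}
    (hr : IdealIsRegular (arrangementIdeal L) r) : (d : ℤ) ≤ r := by
  classical
  by_contra hlt
  obtain ⟨q, hqL, hq⟩ := h.exists_point
  obtain ⟨F, hF⟩ := hr
  have hgen : ∀ α, aeval q (F.aug (Pi.single α 1) : MvPolynomial (Fin (n + 1)) k) = 0 := by
    intro α
    have hα : (F.aug (Pi.single α 1) : MvPolynomial (Fin (n + 1)) k) ∈
        gradedPiece k (Fin (n + 1)) (F.deg 0 α) := F.aug_graded _ _ (single_mem_freePiece _ α)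
    have hdeg := hF 0 α
    rcases lt_or_ge (F.deg 0 α) 0 with hneg | hpos
    · rw [eq_zero_of_mem_gradedPiece_neg hneg hα, map_zero]
    · refine hq _ (F.aug (Pi.single α 1)).2 ?_
      rw [← Int.toNat_of_nonneg hpos, mem_gradedPiece_natCast] at hα
      have := hα.totalDegree_le
      push_cast at hdeg
      omega
  have hall : ∀ f ∈ arrangementIdeal L, aeval q f = 0 := by
    intro f hf
    obtain ⟨v, hv⟩ := F.aug_surjective ⟨f, hf⟩
    have h1 : F.aug v = ∑ α, v α • F.aug (Pi.single α 1) := by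
      conv_lhs => rw [pi_eq_sum_univ' v, map_sum]
      refine Finset.sum_congr rfl fun α _ => ?_
      rw [map_smul]
    have h2 := congrArg Subtype.val h1
    rw [hv, AddSubmonoidClass.coe_finsetSum] at h2
    change f = _ at h2
    rw [h2, map_sum]
    refine Finset.sum_eq_zero fun α _ => ?_
    rw [Submodule.coe_smul, smul_eq_mul, map_mul, hgen, mul_zero]
  choose c hc hcq using fun i => exists_mem_vanishingForms (hqL i)
  have hprod : ∏ i, linearForm k _ (c i) ∈ arrangementIdeal L := by
    refine (Submodule.mem_iInf _).2 fun i => ?_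
    refine Ideal.mem_of_dvd _ (Finset.dvd_prod_of_mem _ (Finset.mem_univ i)) fun x hx => ?_
    rw [aeval_linearForm]
    exact hc i x hx
  have := hall _ hprod
  rw [map_prod, Finset.prod_eq_zero_iff] at this
  obtain ⟨i, -, hi⟩ := this
  rw [aeval_linearForm] at hi
  exact hcq i hi

theorem isLine_projectivization {u v : Fin (n + 1) → k} (h : LinearIndependent k ![u, v]) :
    IsLine (Submodule.projectivization (Submodule.span k {u, v})) := by
  have := finrank_span_eq_card h
  rw [Matrix.range_cons_cons_empty, Fintype.card_fin] at this
  rw [IsLine, OrderIso.apply_symm_apply]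
  exact this

theorem exists_linesMeetingLine [Infinite k] (hn : 2 ≤ n) (d : ℕ) :
    ∃ (A : LinearSubspace k n) (L : Fin d → LinearSubspace k n), LinesMeetingLine A L := by
  obtain ⟨i, j, l, hij, hil, hjl⟩ : ∃ i j l : Fin (n + 1), i ≠ j ∧ i ≠ l ∧ j ≠ l :=
    ⟨⟨0, by omega⟩, ⟨1, by omega⟩, ⟨2, by omega⟩, by simp, by simp, by simp⟩
  -- Distinct scalars `t m` give distinct points `e i + t m • e j` of `A`; each is joined to the
  -- point `e l` off `A`.
  let t : Fin d → k := fun m => Infinite.natEmbedding k m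
  have ht : Function.Injective t := fun a b hab =>
    Fin.ext ((Infinite.natEmbedding k).injective hab)
  let e : Fin (n + 1) → Fin (n + 1) → k := fun i => Pi.single i 1
  let P : Fin d → Fin (n + 1) → k := fun m => e i + t m • e j
  have hPi : ∀ m, P m i = 1 := fun m => by simp [P, e, hij]
  have hPj : ∀ m, P m j = t m := fun m => by simp [P, e, hij]
  have hP0 : ∀ m, P m ≠ 0 := fun m h0 => by simpa [hPi] using congrFun h0 i
  refine ⟨Submodule.projectivization (Submodule.span k {e i, e j}),
    fun m => Submodule.projectivization (Submodule.span k {P m, e l}),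
    isLine_projectivization ?_, fun m => ⟨isLine_projectivization ?_, fun heq => ?_⟩,
    fun m => Projectivization.mk k (P m) (hP0 m), fun a b hab => ?_, fun m => ⟨?_, ?_⟩⟩
  · rw [LinearIndependent.pair_iff]
    intro x y hxy
    have h1 := congrFun hxy i
    have h2 := congrFun hxy j
    simp [e, hij, hij.symm] at h1 h2
    exact ⟨h1, h2⟩
  · rw [LinearIndependent.pair_iff]
    intro x y hxy
    have h1 := congrFun hxy i
    have h2 := congrFun hxy l
    simp [P, e, hij, hil, hil.symm, hjl.symm] at h1 h2
    exact ⟨h1, h2⟩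
  · have h1 : e l ∈ Submodule.span k {e i, e j} := by
      rw [← (Submodule.projectivization (K := k)).injective heq]
      exact Submodule.subset_span (by simp)
    obtain ⟨x, y, hxy⟩ := Submodule.mem_span_pair.1 h1
    have := congrFun hxy l
    simp [e, hil.symm, hjl.symm] at this
  · rw [Projectivization.mk_eq_mk_iff'] at hab
    obtain ⟨x, hx⟩ := hab
    have h1 := congrFun hx i
    have h2 := congrFun hx j
    rw [Pi.smul_apply, smul_eq_mul] at h1 h2
    rw [hPi, hPi, mul_one] at h1
    rw [hPj, hPj, h1, one_mul] at h2
    exact (ht h2).symm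
  · rw [Submodule.mk_mem_projectivization_iff]
    exact Submodule.subset_span (by simp)
  · rw [Submodule.mk_mem_projectivization_iff]
    exact Submodule.mem_span_pair.2 ⟨1, t m, by simp [P]⟩

theorem arrangementIdeal_eq_linearIdealInf [Infinite k] (L : Fin d → LinearSubspace k n) :
    arrangementIdeal L = linearIdealInf
      (fun i => vanishingForms (Projectivization.Subspace.submodule (L i))) Finset.univ := by
  simp only [arrangementIdeal, linearSubspaceIdeal, vanishingIdeal_eq_linearFormIdeal,
    linearIdealInf, Finset.mem_univ, iInf_pos]

end Sharpness

end SubspaceArrangement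

theorem theorem2p1 {k : Type*} [Field k] [Infinite k] (n d : ℕ) :
    (∀ L : Fin d → LinearSubspace k n, IdealIsRegular (arrangementIdeal L) (d : ℤ)) ∧
    (∀ (A : LinearSubspace k n) (L : Fin d → LinearSubspace k n), LinesMeetingLine A L →
      ∀ r : ℤ, IdealIsRegular (arrangementIdeal L) r → (d : ℤ) ≤ r) ∧
    (2 ≤ n → ∃ (A : LinearSubspace k n) (L : Fin d → LinearSubspace k n),
      LinesMeetingLine A L) := by
  refine ⟨fun L => ?_, fun A L h r hr => h.le_of_isRegular hr,
    fun hn => exists_linesMeetingLine hn d⟩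
  rw [arrangementIdeal_eq_linearIdealInf]
  refine idealIsRegular_of_regularPieces (isGradedIdeal_linearIdealInf _ _) ?_
  simpa using regularPieces_linearIdealInf Finset.univ
    fun i => vanishingForms (Projectivization.Subspace.submodule (L i))
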